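/- Notation. An $[n,n-r]_qR$ code is a linear code $C\subseteq\mathbb F_q^n$ of codimension $r$ whose covering radius (the least $\rho$ such that every vector of $\mathbb F_q^n$ is at Hamming distance at most $\rho$ from $C$) equals $R$. Put $V_q(n,R)=\sum_{i=0}^{R}(q-1)^i\binom ni$. An infinite family of covering codes is a sequence of $[n,n-r_n]_qR$ codes $C_n$, one for each length $n\ge n_{\min}$, with $r_n$ nondecreasing; $C_n$ is a supporting code if $n=n_{\min}$ or $r_n>r_{n-1}$. Its lower asymptotic covering density is $\overline\mu_q=\liminf_{n\to\infty}V_q(n,R)/q^{r_n}$. A point set $S$ of a projective space is $\varrho$-saturating if every point lies in the subspace generated by some $\varrho+1$ points of $S$ and $\varrho$ is the least integer with this property. A code is related to $S$ if it has a parity-check matrix whose columns are homogeneous coordinates of the points of $S$, one column for each point. Theorem. Let $R\ge 4$ and fix $\gamma\in\{2,3,\dots,R-1\}$. For $q>1$ put $$n^{(\gamma)}_{R,q}=\frac{\sum_{i=1}^{\gamma+1}(\sqrt[R]{q}-1)^i\binom{R+\gamma}{i}}{\sqrt[R]{q}-1}.$$ Then $n^{(\gamma)}_{R,q}\sim\binom{R+\gamma}{R-1}q^{\gamma/R}$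 as $q\to\infty$. Moreover, for each prime power $q'$ and $q=(q')^R$ there are an integer $w=w(R,\gamma,q)$ with $0\le w\le R-3$ and an infinite family of covering codes over $\mathbb F_q$ of covering radius $R$ such that: (i) the supporting codes of the family are exactly $[n,n-r]_qR$ codes, one for each $t$ with $t=1$ or with $t\ge1$ and $q^{t-1}\ge n^{(\gamma)}_{R,q}$, where $$r=Rt+\gamma,\qquad n=n^{(\gamma)}_{R,q}\,q^{\frac{r-(R+\gamma)}{R}}+w\,\frac{q^{\frac{r-(R+\gamma)}{R}}-1}{q-1};$$ (ii) the supporting code with $t=1$ is related to the set $B_{R-1}$ of the points of the subgeometry $PG(R+\gamma-1,q')\subset PG(R+\gamma-1,q)$ of Hamming weight at most $\gamma+1$, and $B_{R-1}$ is an $(R-1)$-saturating set of $PG(R+\gamma-1,q)$; (iii) $\overline\mu_q$ is bounded from above by a constant that depends only on $R$ and $\gamma$, and $$\overline\mu_q=\frac1{R!}\binom{R+\gamma}{R-1}^{R}+o(1)\qquad\text{as } q=(q')^R\to\infty$$ for fixed $R$ and $\gamma$, so that the main term of the density does not depend on $q$. -/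

import Mathlib

universe u

open Filter Topology
open scoped ENNReal LinearAlgebra.Projectivization

/-- The codimension (redundancy) of a linear code `C` of length `n`: `C` is an `[n, n - r]` code
exactly when its codimension is `r`. -/
noncomputable def codeCodim {F : Type u} [Field F] {n : ℕ} (C : Submodule F (Fin n → F)) : ℕ :=
  Module.finrank F ((Fin n → F) ⧸ C)

/-- `R` is the covering radius of `C`: the least integer such that the spheres of radius `R`
(in the Hamming distance) centred at codewords cover the whole space. -/
def HasCoveringRadius {F : Type u} [Field F] [DecidableEq F] {n : ℕ}
    (C : Submodule F (Fin n → F)) (R : ℕ) : Prop :=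
  IsLeast {ρ : ℕ | ∀ v : Fin n → F, ∃ c ∈ C, hammingDist v c ≤ ρ} R

/-- `V_q(n, R)`, the number of vectors in a Hamming sphere of radius `R` in `F_q ^ n`. -/
def sphereCard (q n R : ℕ) : ℕ :=
  ∑ i ∈ Finset.range (R + 1), (q - 1) ^ i * n.choose i

/-- The covering density `V_q(n, R) / q ^ r` of an `[n, n - r]_q R` code. -/
noncomputable def coveringDensity (q n R r : ℕ) : ℝ≥0∞ :=
  (sphereCard q n R : ℝ≥0∞) / (q : ℝ≥0∞) ^ r

/-- An infinite family of covering codes over `F` with covering radius `R`: one `[n, n - r_n] R`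
code for every length `n ≥ start`, with nondecreasing codimensions `r_n`. (The values of `code`
below `start` play no role.) -/
structure CoveringFamily (F : Type u) [Field F] [DecidableEq F] (R : ℕ) where
  start : ℕ
  code : (n : ℕ) → Submodule F (Fin n → F)
  radius : ∀ n, start ≤ n → HasCoveringRadius (code n) R
  codim_mono : ∀ n, start ≤ n → codeCodim (code n) ≤ codeCodim (code (n + 1))

/-- `n` is the length of a supporting code of the family: the first code, or one whose codimension
exceeds that of its predecessor. All other codes of the family are filling codes. -/
def CoveringFamily.IsSupporting {F : Type u} [Field F] [DecidableEq F] {R : ℕ}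
    (A : CoveringFamily F R) (n : ℕ) : Prop :=
  A.start ≤ n ∧ (n = A.start ∨ codeCodim (A.code (n - 1)) < codeCodim (A.code n))

/-- The lower limit, over all lengths, of the covering densities of the codes of the family. -/
noncomputable def CoveringFamily.lowerDensity {F : Type u} [Field F] [Fintype F] [DecidableEq F]
    {R : ℕ} (A : CoveringFamily F R) : ℝ≥0∞ :=
  liminf (fun n => coveringDensity (Fintype.card F) n R (codeCodim (A.code n))) atTop

/-- `S` is a `ρ`-saturating set of the projective space of `F ^ N`: each point lies in the subspace
generated by some `ρ + 1` points of `S`, and `ρ` is the least value with this property. -/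
def IsSaturating {F : Type u} [Field F] {N : ℕ} (ρ : ℕ) (S : Set (ℙ F (Fin N → F))) : Prop :=
  IsLeast {k : ℕ | ∀ x : ℙ F (Fin N → F), ∃ p : Fin (k + 1) → ℙ F (Fin N → F),
    (∀ i, p i ∈ S) ∧ x.submodule ≤ ⨆ i, (p i).submodule} ρ

/-- The set `B_k` in the subgeometry `PG(N - 1, s)` of `PG(N - 1, F)`, where `|F|` is a power of
`s`: the points having a coordinate vector with entries in the subfield `F_s = {a | a ^ s = a}` and
with at least `k` zero coordinates, i.e. of Hamming weight at most `N - k`. -/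
def lowWeightPoints (F : Type u) [Field F] [DecidableEq F] (s N k : ℕ) :
    Set (ℙ F (Fin N → F)) :=
  {P | ∃ (x : Fin N → F) (hx : x ≠ 0), (∀ i, x i ^ s = x i) ∧ hammingNorm x + k ≤ N ∧
    P = Projectivization.mk F x hx}

/-- `C` is a code related to the point set `S`: `C` has a parity-check matrix whose columns are
homogeneous coordinates of the points of `S`, one column for each point. -/
def IsRelatedCode {F : Type u} [Field F] {n N : ℕ} (C : Submodule F (Fin n → F))
    (S : Set (ℙ F (Fin N → F))) : Prop :=
  ∃ (h : Fin n → Fin N → F) (h0 : ∀ j, h j ≠ 0),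
    Function.Injective (fun j => Projectivization.mk F (h j) (h0 j)) ∧
    Set.range (fun j => Projectivization.mk F (h j) (h0 j)) = S ∧
    ∀ c : Fin n → F, c ∈ C ↔ ∑ j, c j • h j = 0

/-- The starting length `n_{R,q}^{(γ)}`, as a function of a real variable `q`. -/
noncomputable def startLength (R γ : ℕ) (q : ℝ) : ℝ :=
  (∑ i ∈ Finset.Icc 1 (γ + 1), (q ^ (1 / (R : ℝ)) - 1) ^ i * ((R + γ).choose i : ℝ)) /
    (q ^ (1 / (R : ℝ)) - 1)

/-- The length, as a function of the codimension `r`, of the supporting codes of the family. -/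
noncomputable def familyLength (R γ w : ℕ) (q : ℝ) (r : ℕ) : ℝ :=
  startLength R γ q * q ^ (((r : ℝ) - ((R : ℝ) + γ)) / R) +
    w * ((q ^ (((r : ℝ) - ((R : ℝ) + γ)) / R) - 1) / (q - 1))

/-- The admissible values of `t`: `t = 1`, and all `t` with `q ^ (t - 1) ≥ n_{R,q}^{(γ)}`. -/
def IsAdmissible (R γ : ℕ) (q : ℝ) (t : ℕ) : Prop :=
  t = 1 ∨ (1 ≤ t ∧ startLength R γ q ≤ q ^ (t - 1))

/-! A code with given parity-check columns has covering radius at most R exactly when every syndrome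
is a combination of at most R columns. Let `k` be the subfield with q' elements, so that F has
degree R over `k`, and take as columns the points over `k` of weight at most γ + 1 in F^(R+γ). For
any vector a, some R of its entries span all the others over `k`. Expressing the others through
these R entries, as in a reduced echelon form, writes a as a combination of R vectors over `k` with
at least R - 1 zeros each (`exists_lowWeight_decomposition`). Conversely, the entries of a
combination of columns lie in the `k`-span of its coefficients, so a vector whose entries span F
needs at least R columns (`finrank_le_of_isShortCombination`).

Larger codimensions come from a lift that adds R blocks with values in the extension K of degree m.
If the old part of a syndrome uses ρ columns with distinct labels β_j in K, a Vandermonde system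
adjusts the first ρ blocks at no cost, and each remaining block costs one further column
(`isShortCombination_liftColumns`). Every vector is a combination of at least three and at most R
columns: shorter ones are lengthened by adding a relation between three columns
(`exists_combination_three_le`). So only R - 3 blocks need columns of their own, which is the value
of w. Distinct labels require n ≤ q^m, the admissibility condition, and projection to the old part
preserves the lower bound R.

Zero columns fill the lengths in between. For a fixed codimension the density grows with the length,
so the lower limit is the limit along the supporting codes; its main term comes from the leading
term of the starting length as a polynomial in q^(1/R) - 1. -/

/-! ### Short linear combinations of columns -/

section Combinations

variable {F V ι : Type*} [Field F] [DecidableEq F] [AddCommGroup V] [Module F V] [Fintype ι]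

/-- `y` is a linear combination of at most `r` members of the family `h`. -/
def IsShortCombination (h : ι → V) (r : ℕ) (y : V) : Prop :=
  ∃ v : ι → F, ∑ i, v i • h i = y ∧ hammingNorm v ≤ r

theorem hammingNorm_add_le (v w : ι → F) :
    hammingNorm (v + w) ≤ hammingNorm v + hammingNorm w := by
  classical
  unfold hammingNorm
  refine (Finset.card_le_card ?_).trans (Finset.card_union_le _ _)
  intro i
  simp only [Finset.mem_filter, Finset.mem_univ, true_and, Finset.mem_union, Pi.add_apply]
  intro hi
  by_contra! hc
  exact hi (by rw [hc.1, hc.2, add_zero])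

theorem IsShortCombination.mono {h : ι → V} {r s : ℕ} {y : V}
    (hy : IsShortCombination (F := F) h r y) (hrs : r ≤ s) : IsShortCombination (F := F) h s y :=
  let ⟨v, hv, hr⟩ := hy
  ⟨v, hv, hr.trans hrs⟩

theorem IsShortCombination.zero (h : ι → V) : IsShortCombination (F := F) h 0 0 :=
  ⟨0, by simp, by simp⟩

theorem IsShortCombination.add {h : ι → V} {r s : ℕ} {y z : V}
    (hy : IsShortCombination (F := F) h r y) (hz : IsShortCombination (F := F) h s z) :
    IsShortCombination (F := F) h (r + s) (y + z) := by
  obtain ⟨v, rfl, hr⟩ := hy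
  obtain ⟨w, rfl, hs⟩ := hz
  refine ⟨v + w, ?_, (hammingNorm_add_le v w).trans (Nat.add_le_add hr hs)⟩
  simp [add_smul, Finset.sum_add_distrib]

theorem IsShortCombination.smul_apply (h : ι → V) (c : F) (i : ι) :
    IsShortCombination (F := F) h 1 (c • h i) := by
  classical
  refine ⟨Pi.single i c, ?_, ?_⟩
  · rw [Finset.sum_eq_single i] <;> simp +contextual
  · unfold hammingNorm
    refine (Finset.card_le_card (t := {i}) ?_).trans (by simp)
    intro j
    simp only [Finset.mem_filter, Finset.mem_univ, true_and, Finset.mem_singleton]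
    intro hj
    by_contra hne
    exact hj (by simp [hne])

theorem IsShortCombination.sum {κ : Type*} {h : ι → V} {S : Finset κ} {r : κ → ℕ} {y : κ → V}
    (hy : ∀ s ∈ S, IsShortCombination (F := F) h (r s) (y s)) :
    IsShortCombination (F := F) h (∑ s ∈ S, r s) (∑ s ∈ S, y s) := by
  classical
  induction S using Finset.induction_on with
  | empty => simpa using IsShortCombination.zero h
  | insert a S ha ih =>
    rw [Finset.sum_insert ha, Finset.sum_insert ha]
    exact (hy a (Finset.mem_insert_self a S)).add
      (ih fun s hs => hy s (Finset.mem_insert_of_mem hs))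

theorem IsShortCombination.sum_smul {κ : Type*} (h : ι → V) (S : Finset κ) (c : κ → F)
    (g : κ → ι) : IsShortCombination (F := F) h S.card (∑ s ∈ S, c s • h (g s)) := by
  simpa using IsShortCombination.sum (S := S) (r := fun _ => 1)
    fun s _ => IsShortCombination.smul_apply h (c s) (g s)

/-- Padding with zero columns changes no combination length; this produces the filling codes. -/
theorem isShortCombination_extend {κ : Type*} [Fintype κ] {h : ι → V} {g : ι → κ}
    (hg : Function.Injective g) {r : ℕ} {y : V} :
    IsShortCombination (F := F) (Function.extend g h 0) r y ↔
      IsShortCombination (F := F) h r y := by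
  classical
  constructor
  · rintro ⟨v, rfl, hr⟩
    refine ⟨v ∘ g, ?_, le_trans ?_ hr⟩
    · rw [← Finset.sum_subset (Finset.subset_univ (Finset.univ.image g)),
        Finset.sum_image (fun a _ b _ hab => hg hab)]
      · simp [hg.extend_apply]
      · intro j _ hj
        rw [Function.extend_apply' _ _ _ (by simpa using hj)]
        simp
    · unfold hammingNorm
      refine Finset.card_le_card_of_injOn g ?_ (hg.injOn)
      intro i
      simp
  · rintro ⟨v, rfl, hr⟩
    have := (IsShortCombination.sum_smul (Function.extend g h 0)
      (Finset.univ.filter fun i => v i ≠ 0) v g).mono hr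
    convert this using 1
    simp only [hg.extend_apply]
    refine (Finset.sum_filter_of_ne ?_).symm
    intro i _ hi h0
    exact hi (by simp [h0])

end Combinations

/-! ### Covering radius and codimension from columns -/

section Codes

variable {F : Type u} {V ι : Type*} [Field F] [DecidableEq F] [AddCommGroup V] [Module F V]
  [Fintype ι] {R n : ℕ}

/-- Differences between `v` and codewords are exactly the vectors with the syndrome of `v`, so the
distance from `v` to the code is the least weight of a combination giving that syndrome. -/
theorem hasCoveringRadius_ker (h : Fin n → V) (hcov : ∀ y, IsShortCombination (F := F) h R y)
    {y₀ : V} (hlow : ∀ r, IsShortCombination (F := F) h r y₀ → R ≤ r) :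
    HasCoveringRadius (LinearMap.ker (Fintype.linearCombination F h)) R := by
  constructor
  · intro v
    obtain ⟨e, he, hr⟩ := hcov (∑ i, v i • h i)
    refine ⟨v - e, ?_, ?_⟩
    · simp [Fintype.linearCombination_apply, sub_smul, he]
    · rw [hammingDist_comm, hammingDist_eq_hammingNorm]
      simpa using hr
  · intro ρ hρ
    obtain ⟨v, hv, -⟩ := hcov y₀
    obtain ⟨c, hc, hd⟩ := hρ v
    refine hlow ρ ⟨-c + v, ?_, ?_⟩
    · rw [LinearMap.mem_ker, Fintype.linearCombination_apply] at hc
      simp [add_smul, Finset.sum_add_distrib, hc, hv]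
    · rwa [← hammingDist_eq_hammingNorm, hammingDist_comm]

theorem codeCodim_ker (h : Fin n → V) (hcov : ∀ y, IsShortCombination (F := F) h R y) :
    codeCodim (LinearMap.ker (Fintype.linearCombination F h)) = Module.finrank F V := by
  refine LinearEquiv.finrank_eq (LinearMap.quotKerEquivOfSurjective _ ?_)
  intro y
  obtain ⟨v, hv, -⟩ := hcov y
  exact ⟨v, by rw [Fintype.linearCombination_apply, hv]⟩

/-- A family of columns whose short combinations fill the space gives a code of every length that
is at least the number of columns. -/
theorem exists_code_of_columns (h : ι → V) (hcov : ∀ y, IsShortCombination (F := F) h R y)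
    {y₀ : V} (hlow : ∀ r, IsShortCombination (F := F) h r y₀ → R ≤ r)
    (hn : Fintype.card ι ≤ n) :
    ∃ C : Submodule F (Fin n → F), HasCoveringRadius C R ∧ codeCodim C = Module.finrank F V := by
  obtain ⟨g⟩ : Nonempty (ι ↪ Fin n) := Function.Embedding.nonempty_of_card_le (by simpa using hn)
  have hcov' : ∀ y, IsShortCombination (F := F) (Function.extend g h 0) R y :=
    fun y => (isShortCombination_extend g.injective).2 (hcov y)
  exact ⟨_, hasCoveringRadius_ker _ hcov' (y₀ := y₀)
    fun r hr => hlow r ((isShortCombination_extend g.injective).1 hr), codeCodim_ker _ hcov'⟩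

end Codes

/-! ### Vectors over a subfield -/

section Subfield

variable {F : Type*} [Field F]

/-- Each entry of `a` is a `k`-combination of the nonzero coefficients, so these already span F over
`k`. -/
theorem finrank_le_of_isShortCombination [DecidableEq F] {ι : Type*} [Fintype ι] (k : Subfield F) {N r : ℕ} {x : ι → Fin N → F}
    (hx : ∀ i j, x i j ∈ k) {a : Fin N → F} (ha : Submodule.span k (Set.range a) = ⊤)
    (h : IsShortCombination (F := F) x r a) : Module.finrank k F ≤ r := by
  classical
  obtain ⟨v, hv, hr⟩ := h
  refine le_trans ?_ hr
  set S := Finset.univ.filter fun i => v i ≠ 0 with hS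
  have hspan : Submodule.span k ((S.image v : Finset F) : Set F) = ⊤ := by
    rw [eq_top_iff, ← ha, Submodule.span_le]
    rintro _ ⟨j, rfl⟩
    have : a j = ∑ i ∈ S, (⟨x i j, hx i j⟩ : k) • v i := by
      rw [← hv, Finset.sum_apply, hS, Finset.sum_filter_of_ne]
      · refine Finset.sum_congr rfl fun i _ => ?_
        simp [Subfield.smul_def, mul_comm]
      · intro i _ hi h0
        exact hi (by simp [h0])
    rw [this]
    refine Submodule.sum_mem _ fun i hi => Submodule.smul_mem _ _ (Submodule.subset_span ?_)
    exact Finset.mem_coe.2 (Finset.mem_image_of_mem v hi)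
  have := finrank_span_finset_le_card (R := k) (S.image v)
  rw [Set.finrank, hspan, finrank_top] at this
  exact this.trans Finset.card_image_le

theorem exists_span_range_eq_top (k : Subfield F) [FiniteDimensional k F] {N : ℕ}
    (hN : Module.finrank k F ≤ N) :
    ∃ a : Fin N → F, Submodule.span k (Set.range a) = ⊤ := by
  let b := Module.finBasis k F
  refine ⟨fun j => if h : (j : ℕ) < Module.finrank k F then b ⟨j, h⟩ else 0, ?_⟩
  rw [eq_top_iff, ← b.span_eq]
  refine Submodule.span_mono ?_
  rintro _ ⟨i, rfl⟩
  exact ⟨⟨i, i.2.trans_le hN⟩, by simp⟩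

theorem exists_finset_span_image (k : Subfield F) [FiniteDimensional k F] {N R : ℕ}
    (hR : Module.finrank k F ≤ R) (hRN : R ≤ N) (a : Fin N → F) :
    ∃ T : Finset (Fin N), T.card = R ∧ ∀ j, a j ∈ Submodule.span k (a '' T) := by
  classical
  obtain ⟨κ, f, hf, hspan, hli⟩ := exists_linearIndependent' k a
  have : Finite κ := Finite.of_injective f hf
  have := Fintype.ofFinite κ
  have hκ : (Finset.univ.image f).card ≤ R := by
    rw [Finset.card_image_of_injective _ hf]
    exact hli.fintype_card_le_finrank.trans hR
  -- Enlarging to exactly R positions keeps the span and later yields R - 1 zeros even if the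
  -- entries of `a` span less than F.
  obtain ⟨T, hT, hcard⟩ := Finset.exists_superset_card_eq hκ (by simpa using hRN)
  refine ⟨T, hcard, fun j => ?_⟩
  have hj : a j ∈ Submodule.span k (Set.range (a ∘ f)) :=
    hspan ▸ Submodule.subset_span (Set.mem_range_self j)
  refine Submodule.span_mono ?_ hj
  rintro _ ⟨i, rfl⟩
  exact ⟨f i, hT (by simp), rfl⟩

/-- The reduced echelon form: a vector over an extension of degree `R` is a combination of `R`
vectors over the subfield each of which vanishes in `R - 1` positions. -/
theorem exists_lowWeight_decomposition [DecidableEq F] (k : Subfield F) [FiniteDimensional k F] {N R : ℕ}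
    (hR : Module.finrank k F ≤ R) (hRN : R ≤ N) (a : Fin N → F) :
    ∃ (c : Fin R → F) (x : Fin R → Fin N → F), (∀ i j, x i j ∈ k) ∧ (∀ i, x i ≠ 0) ∧
      (∀ i, hammingNorm (x i) + (R - 1) ≤ N) ∧ a = ∑ i, c i • x i := by
  classical
  obtain ⟨T, hT, ha⟩ := exists_finset_span_image k hR hRN a
  let e : Fin R ≃ T := (T.equivFinOfCardEq hT).symm
  have himg : a '' T = Set.range fun i => a (e i) := by
    ext y
    constructor
    · rintro ⟨j, hj, rfl⟩
      exact ⟨e.symm ⟨j, hj⟩, by simp⟩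
    · rintro ⟨i, rfl⟩
      exact ⟨e i, (e i).2, rfl⟩
  simp only [himg, Submodule.mem_span_range_iff_exists_fun] at ha
  choose L hL using ha
  -- The vectors form the identity matrix on `T`, so each vanishes at the other R - 1 positions of
  -- `T`; off `T` they carry the coordinates of `a j` in terms of the entries on `T`.
  refine ⟨fun i => a (e i), fun i j => if j ∈ T then (if j = e i then 1 else 0) else L j i,
    ?_, ?_, ?_, ?_⟩
  · intro i j
    dsimp only
    split_ifs
    · exact k.one_mem
    · exact k.zero_mem
    · exact (L j i).2
  · intro i hi
    simpa using congrFun hi (e i)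
  · intro i
    have hsub : (Finset.univ.filter fun j => (if j ∈ T then (if j = e i then (1 : F) else 0)
        else (L j i : F)) ≠ 0) ⊆ (T.erase (e i))ᶜ := by
      intro j
      simp only [Finset.mem_filter, Finset.mem_univ, true_and, Finset.mem_compl,
        Finset.mem_erase, not_and]
      intro h1 h2 h3
      simp [h2, h3] at h1
    have := Finset.card_le_card hsub
    rw [Finset.card_compl, Finset.card_erase_of_mem (e i).2, hT, Fintype.card_fin] at this
    unfold hammingNorm
    lia
  · ext j
    rw [Finset.sum_apply]
    by_cases hj : j ∈ T
    · rw [Finset.sum_eq_single (e.symm ⟨j, hj⟩)]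
      · simp [hj]
      · intro i _ hi
        have : j ≠ e i := fun h => hi (by rw [Equiv.eq_symm_apply]; exact Subtype.ext h.symm)
        simp [hj, this]
      · simp
    · rw [← hL j]
      refine Finset.sum_congr rfl fun i _ => ?_
      simp [hj, Subfield.smul_def, mul_comm]

end Subfield

/-! ### Supports and weights of sums -/

section Support

variable {F ι : Type*} [Field F] [DecidableEq F] [Fintype ι]

/-- The set of the non-zero positions of a vector. -/
def vecSupport (y : ι → F) : Finset ι := Finset.univ.filter fun i => y i ≠ 0

@[simp] theorem mem_vecSupport {y : ι → F} {i : ι} : i ∈ vecSupport y ↔ y i ≠ 0 := by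
  simp [vecSupport]

theorem card_vecSupport (y : ι → F) : (vecSupport y).card = hammingNorm y := rfl

theorem vecSupport_smul {c : F} (hc : c ≠ 0) (y : ι → F) : vecSupport (c • y) = vecSupport y := by
  ext i
  simp [hc]

theorem vecSupport_single [DecidableEq ι] {c : F} (hc : c ≠ 0) (i : ι) :
    vecSupport (Pi.single i c : ι → F) = {i} := by
  ext j
  by_cases h : j = i <;> simp [h, hc]

theorem vecSupport_nonempty {y : ι → F} : (vecSupport y).Nonempty ↔ y ≠ 0 := by
  rw [← Finset.card_pos, card_vecSupport, hammingNorm_pos_iff]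

/-- Positions in exactly one support survive in the sum; common positions may survive or cancel. -/
theorem hammingNorm_add_bounds [DecidableEq ι] (v w : ι → F) :
    hammingNorm v + hammingNorm w ≤
        hammingNorm (v + w) + 2 * (vecSupport v ∩ vecSupport w).card ∧
      hammingNorm (v + w) + (vecSupport v ∩ vecSupport w).card ≤
        hammingNorm v + hammingNorm w := by
  have hu := Finset.card_union_add_card_inter (vecSupport v) (vecSupport w)
  have h1 : vecSupport v ∪ vecSupport w ⊆
      vecSupport (v + w) ∪ (vecSupport v ∩ vecSupport w) := by
    intro i
    simp only [Finset.mem_union, Finset.mem_inter, mem_vecSupport, Pi.add_apply]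
    by_cases hv : v i = 0 <;> by_cases hw : w i = 0 <;> simp [hv, hw]
  have h2 : vecSupport (v + w) ⊆ vecSupport v ∪ vecSupport w := by
    intro i
    simp only [Finset.mem_union, mem_vecSupport, Pi.add_apply]
    by_cases hv : v i = 0 <;> by_cases hw : w i = 0 <;> simp [hv, hw]
  have h3 := (Finset.card_le_card h1).trans (Finset.card_union_le _ _)
  have h4 := Finset.card_le_card h2
  simp only [card_vecSupport] at *
  lia

end Support

/-- The family `x` represents, one vector for each point, the points over the subfield `k` that
have at least `r` zero coordinates. -/
structure IsLowWeightSystem {F ι : Type*} [Field F] [DecidableEq F] {N : ℕ} (k : Subfield F)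
    (r : ℕ) (x : ι → Fin N → F) : Prop where
  mem : ∀ i j, x i j ∈ k
  ne_zero : ∀ i, x i ≠ 0
  weight : ∀ i, hammingNorm (x i) + r ≤ N
  injective : ∀ i j (c : F), x i = c • x j → i = j
  complete : ∀ y : Fin N → F, y ≠ 0 → (∀ j, y j ∈ k) → hammingNorm y + r ≤ N →
    ∃ (i : ι) (c : F), y = c • x i

/-! ### Relations between three low-weight vectors -/

namespace IsLowWeightSystem

variable {F ι : Type*} [Field F] [DecidableEq F] {N r R : ℕ} {k : Subfield F}
  {x : ι → Fin N → F}

theorem exists_index (hx : IsLowWeightSystem k r x) {y : Fin N → F} (h0 : y ≠ 0)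
    (hy : ∀ j, y j ∈ k) (hw : hammingNorm y + r ≤ N) :
    ∃ (i : ι) (c : F), c ≠ 0 ∧ y = c • x i ∧ vecSupport (x i) = vecSupport y := by
  obtain ⟨i, c, h⟩ := hx.complete y h0 hy hw
  have hc : c ≠ 0 := by
    rintro rfl
    exact h0 (by simpa using h)
  exact ⟨i, c, hc, h, by rw [h, vecSupport_smul hc]⟩

variable [Fintype ι]

theorem isShortCombination (hx : IsLowWeightSystem k (R - 1) x) [FiniteDimensional k F]
    (hR : Module.finrank k F ≤ R) (hRN : R ≤ N) (a : Fin N → F) :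
    IsShortCombination (F := F) x R a := by
  obtain ⟨c, y, hy, h0, hw, rfl⟩ := exists_lowWeight_decomposition k hR hRN a
  choose g d hg using fun i => hx.complete (y i) (h0 i) (hy i) (hw i)
  have := IsShortCombination.sum_smul x Finset.univ (fun i => c i * d i) g
  simp only [Finset.card_univ, Fintype.card_fin] at this
  convert this using 2
  conv_lhs => rw [hg]
  rw [smul_smul]

/-- Three low weight vectors `y`, `z`, `y + z` with different supports give a relation between
three members of the system. -/
theorem exists_relation (hx : IsLowWeightSystem k r x) {y z : Fin N → F}
    (hy0 : y ≠ 0) (hy : ∀ j, y j ∈ k) (hyw : hammingNorm y + r ≤ N)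
    (hz0 : z ≠ 0) (hz : ∀ j, z j ∈ k) (hzw : hammingNorm z + r ≤ N)
    (hs0 : y + z ≠ 0) (hsw : hammingNorm (y + z) + r ≤ N)
    (hyz : vecSupport y ≠ vecSupport z) (hys : vecSupport y ≠ vecSupport (y + z))
    (hzs : vecSupport z ≠ vecSupport (y + z)) :
    ∃ w : ι → F, ∑ i, w i • x i = 0 ∧ hammingNorm w = 3 ∧
      (∀ i ∈ vecSupport w, ∃ d : F, d ≠ 0 ∧ (y = d • x i ∨ z = d • x i ∨ y + z = d • x i)) ∧
      ∀ i, y = x i → i ∈ vecSupport w := by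
  classical
  obtain ⟨i, a, ha, hi, hi'⟩ := hx.exists_index hy0 hy hyw
  obtain ⟨j, b, hb, hj, hj'⟩ := hx.exists_index hz0 hz hzw
  obtain ⟨l, c, hc, hl, hl'⟩ := hx.exists_index hs0 (fun m => k.add_mem (hy m) (hz m)) hsw
  -- A vector and its representative share their support, so different supports force different
  -- indices.
  have hij : i ≠ j := fun h => hyz (by rw [← hi', ← hj', h])
  have hil : i ≠ l := fun h => hys (by rw [← hi', ← hl', h])
  have hjl : j ≠ l := fun h => hzs (by rw [← hj', ← hl', h])
  have hsupp : vecSupport (Pi.single i a + Pi.single j b - Pi.single l c : ι → F) = {i, j, l} := by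
    ext m
    simp only [mem_vecSupport, Pi.sub_apply, Pi.add_apply, Finset.mem_insert,
      Finset.mem_singleton]
    by_cases h1 : m = i
    · subst h1; simp [hij, hil, ha]
    by_cases h2 : m = j
    · subst h2; simp [hjl, hij.symm, hb]
    by_cases h3 : m = l
    · subst h3; simp [hjl.symm, hil.symm, hc]
    simp [h1, h2, h3]
  refine ⟨Pi.single i a + Pi.single j b - Pi.single l c, ?_, ?_, ?_, ?_⟩
  · have hsingle : ∀ (m : ι) (d : F), ∑ n, (Pi.single m d : ι → F) n • x n = d • x m := by
      intro m d
      rw [Finset.sum_eq_single m] <;> simp +contextual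
    simp only [Pi.sub_apply, Pi.add_apply, sub_smul, add_smul, Finset.sum_sub_distrib,
      Finset.sum_add_distrib, hsingle]
    rw [← hi, ← hj, ← hl, sub_self]
  · rw [← card_vecSupport, hsupp]
    exact Finset.card_eq_three.2 ⟨i, j, l, hij, hil, hjl, rfl⟩
  · rw [hsupp]
    simp only [Finset.mem_insert, Finset.mem_singleton]
    rintro m (rfl | rfl | rfl)
    · exact ⟨a, ha, Or.inl hi⟩
    · exact ⟨b, hb, Or.inr (Or.inl hj)⟩
    · exact ⟨c, hc, Or.inr (Or.inr hl)⟩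
  · intro m hm
    have := hx.injective m i a (by rw [← hm, hi])
    rw [hsupp, this]
    simp

/-- Unit vectors e_p, e_q and their sum work when p and q differ from a position where `x i` is
nonzero: all three vanish there. -/
theorem exists_relation_avoiding (hx : IsLowWeightSystem k r x) (hN : 2 + r ≤ N) (hN3 : 3 ≤ N)
    (i : ι) : ∃ w : ι → F, ∑ i, w i • x i = 0 ∧ hammingNorm w = 3 ∧ i ∉ vecSupport w := by
  classical
  obtain ⟨m, hm⟩ := vecSupport_nonempty.2 (hx.ne_zero i)
  have hcard : 1 < (Finset.univ.erase m).card := by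
    rw [Finset.card_erase_of_mem (Finset.mem_univ m), Finset.card_univ, Fintype.card_fin]
    lia
  obtain ⟨p, hp, q, hq, hpq⟩ := Finset.one_lt_card.1 hcard
  have hp' : m ≠ p := (Finset.ne_of_mem_erase hp).symm
  have hq' : m ≠ q := (Finset.ne_of_mem_erase hq).symm
  have h1 : vecSupport (Pi.single p 1 : Fin N → F) = {p} := vecSupport_single one_ne_zero p
  have h2 : vecSupport (Pi.single q 1 : Fin N → F) = {q} := vecSupport_single one_ne_zero q
  have h3 : vecSupport (Pi.single p 1 + Pi.single q 1 : Fin N → F) = {p, q} := by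
    ext j
    simp only [mem_vecSupport, Pi.add_apply, Finset.mem_insert, Finset.mem_singleton]
    by_cases ha : j = p
    · subst ha; simp [hpq]
    by_cases hb : j = q
    · subst hb; simp [hpq.symm]
    simp [ha, hb]
  have hmem : ∀ p j : Fin N, (Pi.single p 1 : Fin N → F) j ∈ k := by
    intro p j
    by_cases h : j = p
    · subst h; simp
    · simp [h]
  obtain ⟨w, hw, hw3, hws, -⟩ := hx.exists_relation (y := Pi.single p 1) (z := Pi.single q 1)
    (by simp) (hmem p) (by rw [← card_vecSupport, h1, Finset.card_singleton]; lia)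
    (by simp) (hmem q) (by rw [← card_vecSupport, h2, Finset.card_singleton]; lia)
    (vecSupport_nonempty.1 (by rw [h3]; simp))
    (by rw [← card_vecSupport, h3, Finset.card_pair hpq]; exact hN)
    (by rw [h1, h2]; simpa using hpq)
    (by
      rw [h1, h3]
      intro h
      have : q ∈ ({p} : Finset (Fin N)) := by rw [h]; simp
      exact hpq (Finset.mem_singleton.1 this).symm)
    (by
      rw [h2, h3]
      intro h
      have : p ∈ ({q} : Finset (Fin N)) := by rw [h]; simp
      exact hpq (Finset.mem_singleton.1 this))
  refine ⟨w, hw, hw3, fun hi => ?_⟩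
  obtain ⟨d, hd, h⟩ := hws i hi
  rw [← vecSupport_smul hd] at hm
  rcases h with h | h | h <;> rw [← h] at hm
  · rw [h1, Finset.mem_singleton] at hm
    exact hp' hm
  · rw [h2, Finset.mem_singleton] at hm
    exact hq' hm
  · rw [h3, Finset.mem_insert, Finset.mem_singleton] at hm
    exact hm.elim hp' hq'

/-- The relation joins `x i`, a unit vector e_m with m outside the support of `x i`, and their sum.
If `x j` were proportional to one of the last two, its support would exceed that of `x i` by exactly
m; two candidates for m are available, so one avoids this. -/
theorem exists_relation_of_weight_lt (hx : IsLowWeightSystem k r x) (hr : 1 ≤ r) {i j : ι}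
    (hij : i ≠ j) (hi : hammingNorm (x i) + r < N) :
    ∃ w : ι → F, ∑ i, w i • x i = 0 ∧ hammingNorm w = 3 ∧ i ∈ vecSupport w ∧
      j ∉ vecSupport w := by
  classical
  have hcard : 1 < (vecSupport (x i))ᶜ.card := by
    rw [Finset.card_compl, card_vecSupport, Fintype.card_fin]
    lia
  obtain ⟨m, hm, hmj⟩ : ∃ m ∉ vecSupport (x i),
      vecSupport (x j) \ vecSupport (x i) ≠ {m} := by
    obtain ⟨p, hp, q, hq, hpq⟩ := Finset.one_lt_card.1 hcard
    by_cases h : vecSupport (x j) \ vecSupport (x i) = {p}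
    · refine ⟨q, Finset.mem_compl.1 hq, ?_⟩
      rw [h]
      simpa using hpq
    · exact ⟨p, Finset.mem_compl.1 hp, h⟩
  have hm0 : x i m = 0 := by simpa using hm
  have h1 : vecSupport (Pi.single m 1 : Fin N → F) = {m} := vecSupport_single one_ne_zero m
  have h2 : vecSupport (x i + Pi.single m 1 : Fin N → F) = insert m (vecSupport (x i)) := by
    ext l
    simp only [mem_vecSupport, Pi.add_apply, Finset.mem_insert]
    by_cases h : l = m
    · subst h; simp [hm0]
    · simp [h]
  obtain ⟨l, hl⟩ := vecSupport_nonempty.2 (hx.ne_zero i)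
  have hlm : l ≠ m := fun h => hm (h ▸ hl)
  obtain ⟨w, hw, hw3, hws, hwi⟩ := hx.exists_relation (y := x i) (z := Pi.single m 1)
    (hx.ne_zero i) (hx.mem i) (hx.weight i) (by simp)
    (by
      intro j
      by_cases h : j = m
      · subst h; simp
      · simp [h])
    (by rw [← card_vecSupport, h1, Finset.card_singleton]; lia)
    (vecSupport_nonempty.1 (by rw [h2]; simp))
    (by
      rw [← card_vecSupport, h2, Finset.card_insert_of_notMem hm, card_vecSupport]
      lia)
    (by rw [h1]; intro h; exact hm (h ▸ Finset.mem_singleton_self m))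
    (by rw [h2]; intro h; exact hm (h ▸ Finset.mem_insert_self m _))
    (by
      rw [h1, h2]
      intro h
      have : l ∈ ({m} : Finset (Fin N)) := h ▸ Finset.mem_insert_of_mem hl
      exact hlm (Finset.mem_singleton.1 this))
  refine ⟨w, hw, hw3, hwi i rfl, fun hj => ?_⟩
  obtain ⟨d, hd, h⟩ := hws j hj
  rw [← vecSupport_smul hd] at hmj
  rcases h with h | h | h
  · exact hij (hx.injective i j d h)
  · rw [← h, h1] at hmj
    exact hmj (Finset.sdiff_eq_self_of_disjoint (Finset.disjoint_singleton_left.2 hm))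
  · rw [← h, h2] at hmj
    refine hmj ?_
    rw [Finset.insert_sdiff_of_notMem _ hm, Finset.sdiff_self, insert_empty_eq]

/-- Splitting one coordinate off `x i` gives two vectors of weight below the maximum, hence not
proportional to `x j`. The weights N - r, 1 and N - r - 1 are distinct because N - r ≥ 3. -/
theorem exists_relation_of_weight_eq (hx : IsLowWeightSystem k r x) {i j : ι}
    (hij : i ≠ j) (hr : r + 3 ≤ N) (hi : hammingNorm (x i) + r = N)
    (hj : hammingNorm (x j) + r = N) :
    ∃ w : ι → F, ∑ i, w i • x i = 0 ∧ hammingNorm w = 3 ∧ i ∈ vecSupport w ∧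
      j ∉ vecSupport w := by
  classical
  obtain ⟨m, hm⟩ := vecSupport_nonempty.2 (hx.ne_zero i)
  have hm0 : -x i m ≠ 0 := by simpa using hm
  have h1 : vecSupport (Pi.single m (-x i m) : Fin N → F) = {m} := vecSupport_single hm0 m
  have h2 : vecSupport (x i + Pi.single m (-x i m) : Fin N → F) = (vecSupport (x i)).erase m := by
    ext l
    simp only [mem_vecSupport, Pi.add_apply, Finset.mem_erase]
    by_cases h : l = m
    · subst h; simp
    · simp [h]
  have hc1 := congrArg Finset.card h1
  have hc2 := congrArg Finset.card h2
  rw [Finset.card_singleton] at hc1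
  rw [Finset.card_erase_of_mem hm] at hc2
  have hne : ∀ {u v : Fin N → F}, (vecSupport u).card ≠ (vecSupport v).card →
      vecSupport u ≠ vecSupport v := fun h h' => h (congrArg Finset.card h')
  simp only [card_vecSupport] at hc1 hc2 hne
  obtain ⟨w, hw, hw3, hws, hwi⟩ := hx.exists_relation (y := x i) (z := Pi.single m (-x i m))
    (hx.ne_zero i) (hx.mem i) (hx.weight i) (by simpa using hm0)
    (by
      intro j
      by_cases h : j = m
      · subst h; simpa using hx.mem i j
      · simp [h])
    (by lia) (hammingNorm_pos_iff.1 (by lia)) (by lia) (hne (by lia)) (hne (by lia))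
    (hne (by lia))
  refine ⟨w, hw, hw3, hwi i rfl, fun hjw => ?_⟩
  obtain ⟨d, hd, h⟩ := hws j hjw
  rw [← card_vecSupport, ← vecSupport_smul hd, card_vecSupport] at hj
  rcases h with h | h | h
  · exact hij (hx.injective i j d h)
  · rw [← h] at hj
    lia
  · rw [← h] at hj
    lia

/-- Every vector is a combination of at least three and at most `R` members of the system. -/
theorem exists_combination_three_le (hx : IsLowWeightSystem k (R - 1) x) [FiniteDimensional k F]
    (hk : Module.finrank k F ≤ R) (hR : 4 ≤ R) (hRN : R + 2 ≤ N) (a : Fin N → F) :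
    ∃ v : ι → F, ∑ i, v i • x i = a ∧ 3 ≤ hammingNorm v ∧ hammingNorm v ≤ R := by
  classical
  obtain ⟨v, hv, hvR⟩ := hx.isShortCombination hk (by lia) a
  by_cases h3 : 3 ≤ hammingNorm v
  · exact ⟨v, hv, h3, hvR⟩
  -- With c common positions, the weight of `v + w` lies between ‖v‖ + 3 - 2c and ‖v‖ + 3 - c, hence
  -- between 3 and 4 ≤ R. The overlap sought is c = 0 for ‖v‖ ≤ 1 and c = 1 for ‖v‖ = 2.
  suffices h : ∃ w : ι → F, ∑ i, w i • x i = 0 ∧ hammingNorm w = 3 ∧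
      2 * (vecSupport v ∩ vecSupport w).card ≤ hammingNorm v ∧
      hammingNorm v ≤ (vecSupport v ∩ vecSupport w).card + 1 by
    obtain ⟨w, hw, hw3, hle, hge⟩ := h
    have := hammingNorm_add_bounds v w
    refine ⟨v + w, ?_, by lia, by lia⟩
    simp [add_smul, Finset.sum_add_distrib, hv, hw]
  by_cases h2 : hammingNorm v = 2
  · obtain ⟨i, j, hij, hs⟩ := Finset.card_eq_two.1 ((card_vecSupport v).trans h2)
    have key : ∃ w : ι → F, ∑ i, w i • x i = 0 ∧ hammingNorm w = 3 ∧
        (i ∈ vecSupport w ∧ j ∉ vecSupport w ∨ j ∈ vecSupport w ∧ i ∉ vecSupport w) := by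
      by_cases hi : hammingNorm (x i) + (R - 1) < N
      · obtain ⟨w, h1, h2, h3⟩ := hx.exists_relation_of_weight_lt (by lia) hij hi
        exact ⟨w, h1, h2, Or.inl h3⟩
      by_cases hj : hammingNorm (x j) + (R - 1) < N
      · obtain ⟨w, h1, h2, h3⟩ := hx.exists_relation_of_weight_lt (by lia) hij.symm hj
        exact ⟨w, h1, h2, Or.inr h3⟩
      have hi' := hx.weight i
      have hj' := hx.weight j
      obtain ⟨w, h1, h2, h3⟩ := hx.exists_relation_of_weight_eq hij (by lia) (by lia) (by lia)
      exact ⟨w, h1, h2, Or.inl h3⟩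
    obtain ⟨w, hw, hw3, h⟩ := key
    have hcard : (vecSupport v ∩ vecSupport w).card = 1 := by
      rw [hs]
      rcases h with ⟨h, h'⟩ | ⟨h, h'⟩
      · rw [Finset.insert_inter_of_mem h, Finset.singleton_inter_of_notMem h']
        simp
      · rw [Finset.insert_inter_of_notMem h', Finset.singleton_inter_of_mem h]
        simp
    exact ⟨w, hw, hw3, by lia⟩
  · by_cases h0 : hammingNorm v = 0
    · obtain ⟨i, -⟩ := hx.complete (Pi.single ⟨0, by lia⟩ 1) (by simp)
        (fun j => by
          by_cases h : j = ⟨0, by lia⟩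
          · subst h; simp
          · simp [h])
        (by rw [← card_vecSupport, vecSupport_single one_ne_zero, Finset.card_singleton]; lia)
      obtain ⟨w, hw, hw3, -⟩ := hx.exists_relation_avoiding (by lia) (by lia) i
      have := Finset.card_le_card (Finset.inter_subset_left (s₁ := vecSupport v)
        (s₂ := vecSupport w))
      rw [card_vecSupport v] at this
      exact ⟨w, hw, hw3, by lia⟩
    · obtain ⟨i, hs⟩ := Finset.card_eq_one.1 ((card_vecSupport v).trans
        (by lia : hammingNorm v = 1))
      obtain ⟨w, hw, hw3, hi⟩ := hx.exists_relation_avoiding (by lia) (by lia) i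
      have : (vecSupport v ∩ vecSupport w).card = 0 := by
        rw [hs, Finset.singleton_inter_of_notMem hi, Finset.card_empty]
      exact ⟨w, hw, hw3, by lia⟩

end IsLowWeightSystem

/-! ### The Vandermonde lift -/

section Lift

theorem exists_vandermonde_solution {K : Type*} [Field K] {n : ℕ} {β : Fin n → K}
    (hβ : Function.Injective β) (u : Fin n → K) :
    ∃ η : Fin n → K, ∀ k : Fin n, ∑ i, η i * β i ^ (k : ℕ) = u k := by
  classical
  refine ⟨Matrix.vecMul u (Matrix.vandermonde β)⁻¹, fun k => ?_⟩
  have hdet : IsUnit (Matrix.vandermonde β).det :=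
    isUnit_iff_ne_zero.2 (Matrix.det_vandermonde_ne_zero_iff.2 hβ)
  have : Matrix.vecMul (Matrix.vecMul u (Matrix.vandermonde β)⁻¹) (Matrix.vandermonde β) = u := by
    rw [Matrix.vecMul_vecMul, Matrix.nonsing_inv_mul _ hdet, Matrix.vecMul_one]
  exact congrFun this k

variable {V K ι : Type*} [AddCommGroup V] [Field K]

/-- The columns of the lifted parity-check matrix: `(x_j, ξ, β_j ξ, …, β_j ^ (R - 1) ξ)`, and the
points of the projective space of `K` in each of the last `R - ℓ` blocks. -/
noncomputable def liftColumns (F : Type*) [Field F] [Algebra F K] (R ℓ : ℕ) (x : ι → V) (β : ι → K) :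
    (ι × K) ⊕ ({i : Fin R // ℓ ≤ i} × ℙ F K) → V × (Fin R → K)
  | Sum.inl p => (x p.1, fun i => β p.1 ^ (i : ℕ) * p.2)
  | Sum.inr p => (0, Pi.single p.1.1 p.2.rep)

variable {F : Type*} [Field F] [Module F V] [Algebra F K] [DecidableEq F] [Fintype ι] [Fintype K] [Fintype (ℙ F K)]

theorem isShortCombination_liftColumns {R ℓ : ℕ} {x : ι → V} {β : ι → K}
    (hβ : Function.Injective β)
    (hx : ∀ a, ∃ v : ι → F, ∑ i, v i • x i = a ∧ ℓ ≤ hammingNorm v ∧ hammingNorm v ≤ R)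
    (y : V × (Fin R → K)) : IsShortCombination (F := F) (liftColumns F R ℓ x β) R y := by
  classical
  obtain ⟨a, u⟩ := y
  obtain ⟨v, hv, hℓ, hR⟩ := hx a
  set S := Finset.univ.filter fun i => v i ≠ 0 with hS
  obtain ⟨ρ, hρ⟩ : ∃ ρ, S.card = ρ := ⟨_, rfl⟩
  have hρR : ρ ≤ R := hρ ▸ hR
  have hℓρ : ℓ ≤ ρ := hρ ▸ hℓ
  let e : Fin ρ ≃ S := (S.equivFinOfCardEq hρ).symm
  obtain ⟨η, hη⟩ := exists_vandermonde_solution (β := fun i => β (e i))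
    (fun i j h => e.injective (Subtype.ext (hβ h))) (fun i : Fin ρ => u (Fin.castLE hρR i))
  -- Dividing by `v j` makes the column enter the Vandermonde system with total coefficient η; off
  -- `S` the value 0 is a mere default.
  let ξ : ι → K := fun j => if hj : j ∈ S then (v j)⁻¹ • η (e.symm ⟨j, hj⟩) else 0
  have hξ : ∀ i : Fin ρ, v (e i) • ξ (e i) = η i := by
    intro i
    have h0 : v (e i) ≠ 0 := (Finset.mem_filter.1 (e i).2).2
    simp only [ξ, (e i).2, dif_pos, Subtype.coe_eta, Equiv.symm_apply_apply]
    rw [smul_smul, mul_inv_cancel₀ h0, one_smul]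
  have h1 := IsShortCombination.sum_smul (F := F) (liftColumns F R ℓ x β) S v
    fun j => Sum.inl (j, ξ j)
  rw [hρ] at h1
  set z := ∑ j ∈ S, v j • liftColumns F R ℓ x β (Sum.inl (j, ξ j)) with hz
  have hz1 : z.1 = a := by
    rw [hz, Prod.fst_sum, ← hv, hS]
    refine Finset.sum_filter_of_ne fun i _ hi h0 => hi ?_
    simp [h0, liftColumns]
  have hz2 : ∀ i : Fin R, (i : ℕ) < ρ → z.2 i = u i := by
    intro i hi
    rw [hz, Prod.snd_sum, Finset.sum_apply, ← Finset.sum_coe_sort, ← e.sum_comp]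
    refine Eq.trans ?_ (hη ⟨i, hi⟩)
    refine Finset.sum_congr rfl fun j _ => ?_
    rw [← hξ j]
    simp [liftColumns, mul_comm]
  -- Blocks below ρ are already correct and cost nothing. Each other block has index at least ρ ≥ ℓ,
  -- so its error is a multiple of one available projective column.
  have h2 : IsShortCombination (F := F) (liftColumns F R ℓ x β)
      (∑ i : Fin R, if (i : ℕ) < ρ then 0 else 1)
      (∑ i : Fin R, ((0 : V), (Pi.single i (u i - z.2 i) : Fin R → K))) := by
    refine IsShortCombination.sum fun i _ => ?_
    by_cases h0 : u i - z.2 i = 0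
    · rw [h0, Pi.single_zero]
      exact (IsShortCombination.zero _).mono (Nat.zero_le _)
    have hi : ¬ (i : ℕ) < ρ := fun hi => h0 (by rw [hz2 i hi, sub_self])
    rw [if_neg hi]
    obtain ⟨c, hc⟩ := Projectivization.exists_smul_eq_mk_rep F (u i - z.2 i) h0
    have := IsShortCombination.smul_apply (F := F) (liftColumns F R ℓ x β) (c⁻¹ : Fˣ).1
      (Sum.inr (⟨i, by lia⟩, Projectivization.mk F (u i - z.2 i) h0))
    convert this using 1
    simp only [liftColumns, ← hc, Prod.smul_mk, smul_zero, ← Pi.single_smul]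
    rw [Units.smul_def, smul_smul, ← Units.val_mul, inv_mul_cancel, Units.val_one, one_smul]
  have h3 := h1.add h2
  have hcard : ρ + (∑ i : Fin R, if (i : ℕ) < ρ then 0 else 1) = R := by
    rw [Fin.sum_univ_eq_sum_range (fun i => if i < ρ then 0 else 1) R,
      ← Finset.sum_range_add_sum_Ico _ hρR]
    rw [Finset.sum_eq_zero, Finset.sum_congr rfl (g := fun _ => 1)]
    · simp; lia
    · intro i hi; simp at hi; simp; lia
    · intro i hi; simp at hi; simp [hi]
  rw [hcard] at h3
  convert h3 using 1
  refine Prod.ext ?_ ?_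
  · simp [Prod.fst_sum, hz1]
  · ext i
    simp [Prod.snd_sum, Finset.sum_apply]

end Lift

/-! ### The subfield with s elements -/

section Frobenius

variable {F : Type*} [Field F] [Fintype F]

/-- A field with `s ^ R` elements has a subfield with `s` elements, the solutions of `a ^ s = a`. -/
theorem exists_subfield_of_card_eq_pow {s R : ℕ} (hR : R ≠ 0) (hF : Fintype.card F = s ^ R) :
    ∃ k : Subfield F, (∀ a, a ∈ k ↔ a ^ s = a) ∧ Nat.card k = s ∧ Module.finrank k F = R ∧
      2 ≤ s := by
  classical
  obtain ⟨p, hp⟩ := CharP.exists F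
  obtain ⟨n, hprime, hn⟩ := FiniteField.card F p
  have := Fact.mk hprime
  have hF1 : 1 < s ^ R := hF ▸ Fintype.one_lt_card
  have hs2 : 2 ≤ s := by
    by_contra! h
    interval_cases s <;> simp [hR] at hF1
  -- Since s divides the prime power |F|, it is p^m, and a ↦ a^s is an iterate of Frobenius.
  obtain ⟨m, -, hm⟩ := (Nat.dvd_prime_pow hprime).1 ((hF.symm.trans hn) ▸ dvd_pow_self s hR)
  let k : Subfield F := (iterateFrobenius F p m).eqLocusField (RingHom.id F)
  have hmem : ∀ a, a ∈ k ↔ a ^ s = a := by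
    intro a
    rw [RingHom.mem_eqLocusField, iterateFrobenius_def, RingHom.id_apply, hm]
  -- The units of `k` are the kernel of u ↦ u^(s-1) on the cyclic group of units of F; as s - 1
  -- divides the order of that group, the kernel has s - 1 elements.
  have hdvd : s - 1 ∣ Nat.card Fˣ := by
    rw [Nat.card_units, Nat.card_eq_fintype_card, hF]
    simpa using Nat.sub_dvd_pow_sub_pow s 1 R
  have hunits : Nat.card kˣ = s - 1 := by
    rw [← Nat.gcd_eq_right hdvd, ← IsCyclic.card_powMonoidHom_ker]
    refine Nat.card_congr (Equiv.ofBijective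
      (fun u => ⟨Units.map (k.subtype : k →* F) u, ?_⟩) ⟨?_, ?_⟩)
    · rw [MonoidHom.mem_ker, powMonoidHom_apply, Units.ext_iff]
      have hu := (hmem _).1 u.1.2
      have h0 : (u.1 : F) ≠ 0 := by simp
      have : (u.1 : F) ^ (s - 1) * u.1 = 1 * u.1 := by
        rw [← pow_succ, Nat.sub_add_cancel (by lia), hu, one_mul]
      simpa using mul_right_cancel₀ h0 this
    · intro u v h
      simpa [Units.ext_iff] using h
    · rintro ⟨v, hv⟩
      rw [MonoidHom.mem_ker, powMonoidHom_apply, Units.ext_iff] at hv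
      have hvk : (v : F) ∈ k := by
        rw [hmem, ← Nat.sub_add_cancel (by lia : 1 ≤ s), pow_succ]
        simpa using congrArg (· * (v : F)) hv
      refine ⟨Units.mk0 ⟨v, hvk⟩ ?_, ?_⟩
      · intro h
        exact v.ne_zero (congrArg Subtype.val h)
      · ext
        simp
  have hcard : Nat.card k = s := by
    rw [Nat.card_units] at hunits
    have : 0 < Nat.card k := Nat.card_pos
    lia
  refine ⟨k, hmem, hcard, ?_, hs2⟩
  have h1 := Module.natCard_eq_pow_finrank (K := k) (V := F)
  rw [hcard, Nat.card_eq_fintype_card, hF] at h1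
  exact (Nat.pow_right_injective hs2 h1).symm

end Frobenius

/-! ### Counting low-weight points -/

section Counting

variable {K : Type*} [Field K] [Fintype K] [DecidableEq K] {N : ℕ}

theorem card_vecSupport_eq (S : Finset (Fin N)) :
    (Finset.univ.filter fun y : Fin N → K => vecSupport y = S).card =
      (Fintype.card K - 1) ^ S.card := by
  have h : (Finset.univ.filter fun y : Fin N → K => vecSupport y = S) =
      Fintype.piFinset fun i => if i ∈ S then Finset.univ.erase 0 else {0} := by
    ext y
    simp only [Finset.mem_filter, Finset.mem_univ, true_and, Fintype.mem_piFinset,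
      Finset.ext_iff, mem_vecSupport]
    refine forall_congr' fun i => ?_
    by_cases hi : i ∈ S <;> simp [hi]
  rw [h, Fintype.card_piFinset]
  have : ∀ i, (if i ∈ S then (Finset.univ.erase 0 : Finset K) else {0}).card =
      if i ∈ S then Fintype.card K - 1 else 1 := by
    intro i
    split_ifs
    · rw [Finset.card_erase_of_mem (Finset.mem_univ _), Finset.card_univ]
    · simp
  simp only [this]
  rw [Finset.prod_ite_mem, Finset.univ_inter, Finset.prod_const]

theorem card_hammingNorm_eq (i : ℕ) :
    (Finset.univ.filter fun y : Fin N → K => hammingNorm y = i).card =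
      (Fintype.card K - 1) ^ i * N.choose i := by
  rw [Finset.card_eq_sum_card_fiberwise (f := vecSupport)
    (t := Finset.powersetCard i Finset.univ)]
  · rw [Finset.sum_congr rfl (g := fun _ => (Fintype.card K - 1) ^ i)]
    · rw [Finset.sum_const, Finset.card_powersetCard, Finset.card_univ, Fintype.card_fin,
        smul_eq_mul, mul_comm]
    · intro S hS
      obtain ⟨-, hS⟩ := Finset.mem_powersetCard.1 hS
      rw [Finset.filter_filter, ← hS, ← card_vecSupport_eq S]
      congr 1
      ext y
      simp only [Finset.mem_filter, Finset.mem_univ, true_and, and_iff_right_iff_imp]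
      rintro rfl
      rfl
  · intro y hy
    simp only [Finset.coe_filter, Finset.mem_univ, true_and, Set.mem_ofPred_eq] at hy
    simp [Finset.mem_powersetCard, card_vecSupport, hy]

theorem card_lowWeight (r : ℕ) :
    (Finset.univ.filter fun y : Fin N → K => y ≠ 0 ∧ hammingNorm y + r ≤ N).card =
      ∑ i ∈ Finset.Icc 1 (N - r), (Fintype.card K - 1) ^ i * N.choose i := by
  rw [Finset.card_eq_sum_card_fiberwise (f := hammingNorm) (t := Finset.Icc 1 (N - r))]
  · refine Finset.sum_congr rfl fun i hi => ?_
    rw [Finset.mem_Icc] at hi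
    rw [← card_hammingNorm_eq, Finset.filter_filter]
    congr 1
    ext y
    simp only [Finset.mem_filter, Finset.mem_univ, true_and, and_iff_right_iff_imp]
    rintro rfl
    exact ⟨hammingNorm_pos_iff.1 (by lia), by lia⟩
  · intro y hy
    simp only [Finset.coe_filter, Finset.mem_univ, true_and, Set.mem_ofPred_eq] at hy
    have := hammingNorm_pos_iff.2 hy.1
    simp only [Finset.coe_Icc, Set.mem_Icc]
    lia

omit [Fintype K] in
theorem hammingNorm_units_smul (u : Kˣ) (y : Fin N → K) : hammingNorm (u • y) = hammingNorm y := by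
  rw [Units.smul_def, ← card_vecSupport, vecSupport_smul u.ne_zero, card_vecSupport]

/-- A nonzero vector is a unit times the representative of its point, in a unique way and with the
same weight. -/
theorem card_lowWeight_projectivization_mul (r : ℕ) :
    Nat.card {P : ℙ K (Fin N → K) // hammingNorm P.rep + r ≤ N} * (Nat.card K - 1) =
      ∑ i ∈ Finset.Icc 1 (N - r), (Nat.card K - 1) ^ i * N.choose i := by
  have hcount : Nat.card ({P : ℙ K (Fin N → K) // hammingNorm P.rep + r ≤ N} × Kˣ) =
      Nat.card {y : Fin N → K // y ≠ 0 ∧ hammingNorm y + r ≤ N} := by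
    refine Nat.card_congr (Equiv.ofBijective (fun p => ⟨p.2 • p.1.1.rep, ?_, ?_⟩) ⟨?_, ?_⟩)
    · exact (smul_ne_zero_iff_ne p.2).2 p.1.1.rep_nonzero
    · rw [hammingNorm_units_smul]
      exact p.1.2
    · rintro ⟨P, u⟩ ⟨Q, v⟩ h
      have h' : u • P.1.rep = v • Q.1.rep := congrArg Subtype.val h
      have hPQ : P = Q := by
        refine Subtype.ext ?_
        rw [← P.1.mk_rep, ← Q.1.mk_rep, Projectivization.mk_eq_mk_iff]
        exact ⟨u⁻¹ * v, by rw [mul_smul, ← h', inv_smul_smul]⟩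
      subst hPQ
      obtain ⟨j, hj⟩ : ∃ j, P.1.rep j ≠ 0 := by
        by_contra! h0
        exact P.1.rep_nonzero (funext h0)
      have huv := congrFun h' j
      simp only [Pi.smul_apply, Units.smul_def, smul_eq_mul] at huv
      rw [Units.ext (mul_right_cancel₀ hj huv)]
    · rintro ⟨y, h0, hw⟩
      obtain ⟨u, hu⟩ := Projectivization.exists_smul_eq_mk_rep K y h0
      refine ⟨⟨⟨Projectivization.mk K y h0, ?_⟩, u⁻¹⟩, ?_⟩
      · rwa [← hu, hammingNorm_units_smul]
      · refine Subtype.ext ?_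
        simp only [← hu, inv_smul_smul]
  rw [Nat.card_prod, Nat.card_units,
    Nat.card_eq_fintype_card (α := {y : Fin N → K // y ≠ 0 ∧ hammingNorm y + r ≤ N}),
    Fintype.card_subtype, card_lowWeight, ← Nat.card_eq_fintype_card (α := K)] at hcount
  exact hcount

end Counting

/-! ### Existence of low-weight systems -/

section Existence

theorem exists_isLowWeightSystem {F : Type*} [Field F] [Fintype F] [DecidableEq F]
    (k : Subfield F) (N r : ℕ) :
    ∃ (n : ℕ) (x : Fin n → Fin N → F), IsLowWeightSystem k r x ∧
      n * (Nat.card k - 1) = ∑ i ∈ Finset.Icc 1 (N - r), (Nat.card k - 1) ^ i * N.choose i := by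
  classical
  have := Fintype.ofFinite (ℙ k (Fin N → k))
  let ι := {P : ℙ k (Fin N → k) // hammingNorm P.rep + r ≤ N}
  have hnorm : ∀ y : Fin N → k, hammingNorm (fun j => (y j : F)) = hammingNorm y := fun y =>
    hammingNorm_comp (fun _ (a : k) => (a : F)) (fun _ => Subtype.val_injective) fun _ => rfl
  have hsys : IsLowWeightSystem k r (fun (P : ι) j => (P.1.rep j : F)) := by
    constructor
    · intro P j
      exact (P.1.rep j).2
    · intro P h
      exact P.1.rep_nonzero (funext fun j => Subtype.ext (congrFun h j))
    · intro P
      rw [hnorm]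
      exact P.2
    · intro P Q c h
      obtain ⟨j, hj⟩ : ∃ j, Q.1.rep j ≠ 0 := by
        by_contra! h0
        exact Q.1.rep_nonzero (funext h0)
      -- The factor is a quotient of entries in `k`, so points distinct over `k` stay distinct over
      -- F.
      have hc : c ∈ k := by
        have hj' : (Q.1.rep j : F) ≠ 0 := by simpa using hj
        have : c = (P.1.rep j : F) / Q.1.rep j := by
          rw [eq_div_iff hj']
          exact (congrFun h j).symm
        rw [this]
        exact k.div_mem (P.1.rep j).2 (Q.1.rep j).2
      refine Subtype.ext ?_
      rw [← P.1.mk_rep, ← Q.1.mk_rep, Projectivization.mk_eq_mk_iff']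
      exact ⟨⟨c, hc⟩, funext fun j => Subtype.ext (congrFun h j).symm⟩
    · intro y h0 hy hw
      let z : Fin N → k := fun j => ⟨y j, hy j⟩
      have hz : z ≠ 0 := fun h => h0 (funext fun j => congrArg Subtype.val (congrFun h j))
      obtain ⟨u, hu⟩ := Projectivization.exists_smul_eq_mk_rep k z hz
      have hwz : hammingNorm (Projectivization.mk k z hz).rep + r ≤ N := by
        rw [← hu]
        refine le_trans (Nat.add_le_add_right ?_ r) hw
        exact (hammingNorm_units_smul u z).le.trans (hnorm z).ge
      refine ⟨⟨_, hwz⟩, ((u⁻¹ : kˣ) : k), ?_⟩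
      have : z = (u⁻¹ : kˣ) • (Projectivization.mk k z hz).rep := by
        rw [← hu, inv_smul_smul]
      ext j
      have := congrArg Subtype.val (congrFun this j)
      simpa [Units.smul_def] using this
  let e : Fin (Nat.card ι) ≃ ι := (Finite.equivFin ι).symm
  refine ⟨Nat.card ι, fun i j => ((e i).1.rep j : F), ?_, card_lowWeight_projectivization_mul r⟩
  refine ⟨fun i => hsys.mem _, fun i => hsys.ne_zero _, fun i => hsys.weight _,
    fun i j c h => e.injective (hsys.injective _ _ c h), fun y h0 hy hw => ?_⟩
  obtain ⟨P, c, h⟩ := hsys.complete y h0 hy hw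
  exact ⟨e.symm P, c, by simpa using h⟩

end Existence

/-! ### Related code and saturating set -/

section Points

variable {F : Type u} [Field F] [DecidableEq F] {N n r s R : ℕ} {k : Subfield F}

theorem IsLowWeightSystem.isRelatedCode {x : Fin n → Fin N → F} (hx : IsLowWeightSystem k r x)
    (hk : ∀ a, a ∈ k ↔ a ^ s = a) :
    IsRelatedCode (LinearMap.ker (Fintype.linearCombination F x)) (lowWeightPoints F s N r) := by
  refine ⟨x, hx.ne_zero, ?_, ?_, ?_⟩
  · intro i j h
    obtain ⟨c, hc⟩ := (Projectivization.mk_eq_mk_iff' _ _ _ _ _).1 h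
    exact hx.injective i j c hc.symm
  · ext P
    constructor
    · rintro ⟨i, rfl⟩
      exact ⟨x i, hx.ne_zero i, fun j => (hk _).1 (hx.mem i j), hx.weight i, rfl⟩
    · rintro ⟨y, h0, hy, hw, rfl⟩
      obtain ⟨i, c, h⟩ := hx.complete y h0 (fun j => (hk _).2 (hy j)) hw
      refine ⟨i, ?_⟩
      have hc : c ≠ 0 := by
        rintro rfl
        exact h0 (by simpa using h)
      refine (Projectivization.mk_eq_mk_iff' _ _ _ _ _).2 ⟨c⁻¹, ?_⟩
      rw [h, smul_smul, inv_mul_cancel₀ hc, one_smul]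
  · intro c
    rw [LinearMap.mem_ker, Fintype.linearCombination_apply]

theorem isSaturating_lowWeightPoints [FiniteDimensional k F] (hk : ∀ a, a ∈ k ↔ a ^ s = a)
    (hkR : Module.finrank k F = R) (hR : 1 ≤ R) (hRN : R ≤ N) :
    IsSaturating (R - 1) (lowWeightPoints F s N (R - 1)) := by
  constructor
  · intro P
    induction P using Projectivization.ind with
    | h a ha =>
      obtain ⟨c, x, hxk, hx0, hxw, h⟩ := exists_lowWeight_decomposition k hkR.le hRN a
      have hcast : R - 1 + 1 = R := Nat.sub_add_cancel hR
      refine ⟨fun i => Projectivization.mk F (x (Fin.cast hcast i)) (hx0 _), fun i =>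
        ⟨_, hx0 _, fun j => (hk _).1 (hxk _ j), hxw _, rfl⟩, ?_⟩
      simp only [Projectivization.submodule_mk, Submodule.span_singleton_le_iff_mem]
      rw [h]
      refine Submodule.sum_mem _ fun i _ => Submodule.smul_mem _ _ ?_
      exact Submodule.mem_iSup_of_mem (Fin.cast hcast.symm i) (Submodule.mem_span_singleton_self _)
  · intro l hl
    obtain ⟨a, ha⟩ := exists_span_range_eq_top (N := N) k (hkR.trans_le hRN)
    have ha0 : a ≠ 0 := by
      rintro rfl
      have h1 : (1 : F) ∈ Submodule.span k (Set.range (0 : Fin N → F)) := ha ▸ Submodule.mem_top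
      have h2 : Submodule.span k (Set.range (0 : Fin N → F)) ≤ ⊥ := by
        rw [Submodule.span_le]
        rintro _ ⟨j, rfl⟩
        simp
      simpa using h2 h1
    obtain ⟨p, hp, hle⟩ := hl (Projectivization.mk F a ha0)
    choose x hx0 hxk hxw hpx using hp
    simp only [hpx, Projectivization.submodule_mk, Submodule.span_singleton_le_iff_mem,
      ← Submodule.span_range_eq_iSup, Submodule.mem_span_range_iff_exists_fun] at hle
    obtain ⟨c, hc⟩ := hle
    have := finrank_le_of_isShortCombination k (r := l + 1) (fun i j => (hk _).2 (hxk i j)) ha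
      ⟨c, hc, hammingNorm_le_card_fintype.trans (by simp)⟩
    lia

end Points

/-! ### Codes of the lifted codimensions -/

theorem IsShortCombination.map {F V W ι : Type*} [Field F] [DecidableEq F] [AddCommGroup V]
    [Module F V] [AddCommGroup W] [Module F W] [Fintype ι] {h : ι → V} {r : ℕ} {y : V}
    (hy : IsShortCombination (F := F) h r y) (f : V →ₗ[F] W) :
    IsShortCombination (F := F) (fun i => f (h i)) r (f y) := by
  obtain ⟨v, rfl, hr⟩ := hy
  exact ⟨v, by simp, hr⟩

/-- The length of the code of codimension `R * (m + 1) + γ`, for a starting length `n₀`. -/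
def liftLength (q n₀ w m : ℕ) : ℕ := n₀ * q ^ m + w * ∑ i ∈ Finset.range m, q ^ i

theorem strictMono_liftLength {q n₀ w : ℕ} (hq : 2 ≤ q) (hn₀ : 1 ≤ n₀) :
    StrictMono (liftLength q n₀ w) := by
  refine strictMono_nat_of_lt_succ fun m => ?_
  unfold liftLength
  refine add_lt_add_of_lt_of_le ?_ (Nat.mul_le_mul_left _ ?_)
  · exact Nat.mul_lt_mul_of_pos_left (Nat.pow_lt_pow_right hq (Nat.lt_succ_self m)) hn₀
  · rw [Finset.sum_range_succ]
    exact Nat.le_add_right _ _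

theorem IsLowWeightSystem.exists_code {F : Type u} [Field F] [Fintype F] [DecidableEq F]
    {R γ n₀ m n : ℕ} {k : Subfield F} {x : Fin n₀ → Fin (R + γ) → F}
    (hx : IsLowWeightSystem k (R - 1) x) (hk : Module.finrank k F = R) (hR : 4 ≤ R) (hγ : 2 ≤ γ)
    (hm : m = 0 ∨ n₀ ≤ Fintype.card F ^ m)
    (hn : liftLength (Fintype.card F) n₀ (R - 3) m ≤ n) :
    ∃ C : Submodule F (Fin n → F), HasCoveringRadius C R ∧ codeCodim C = R * (m + 1) + γ := by
  classical
  obtain ⟨a, ha⟩ := exists_span_range_eq_top (N := R + γ) k (hk.trans_le (Nat.le_add_right R γ))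
  -- For m = 0 the original columns serve, with no bound on `n₀`; the extension K and the labels are
  -- needed only for m > 0.
  rcases Nat.eq_zero_or_pos m with rfl | hm0
  · obtain ⟨C, hC, hdim⟩ := exists_code_of_columns (n := n) x
      (hx.isShortCombination hk.le (Nat.le_add_right R γ)) (y₀ := a)
      (fun r hr => hk ▸ finrank_le_of_isShortCombination k hx.mem ha hr)
      (by simpa [liftLength] using hn)
    exact ⟨C, hC, by simp [hdim]⟩
  replace hm := hm.resolve_left hm0.ne'
  obtain ⟨p, hp⟩ := CharP.exists F
  have := Fact.mk (CharP.char_is_prime F p)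
  have : NeZero m := ⟨hm0.ne'⟩
  let K := FiniteField.Extension F p m
  have := Fintype.ofFinite K
  have := Fintype.ofFinite (ℙ F K)
  have hKrank : Module.finrank F K = m := FiniteField.finrank_extension F p m
  have hK : Fintype.card K = Fintype.card F ^ m := by
    rw [← Nat.card_eq_fintype_card, ← Nat.card_eq_fintype_card]
    exact FiniteField.natCard_extension F p m
  obtain ⟨β⟩ : Nonempty (Fin n₀ ↪ K) :=
    Function.Embedding.nonempty_of_card_le (by rwa [Fintype.card_fin, hK])
  have hPK : Fintype.card (ℙ F K) = ∑ i ∈ Finset.range m, Fintype.card F ^ i := by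
    rw [← Nat.card_eq_fintype_card, ← Nat.card_eq_fintype_card,
      Projectivization.card_of_finrank F K hKrank]
  have hblocks : Fintype.card {i : Fin R // 3 ≤ (i : ℕ)} = R - 3 := by
    rw [Fintype.card_congr (Equiv.subtypeEquivRight (q := fun i : Fin R => ⟨3, by lia⟩ ≤ i)
      (fun i => by rw [Fin.le_def])), Fintype.card_subtype]
    rw [Finset.filter_le_eq_Ici, Fin.card_Ici]
  have hmem : ∀ i j, (liftColumns F R 3 x β i).1 j ∈ k := by
    rintro (⟨i, ξ⟩ | ⟨i, P⟩) j
    · exact hx.mem i j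
    · exact k.zero_mem
  -- The syndrome `(a, 0)` needs R columns, since the first components of all lifted columns are
  -- still over `k`.
  obtain ⟨C, hC, hdim⟩ := exists_code_of_columns (n := n) (liftColumns F R 3 x β)
    (isShortCombination_liftColumns β.injective
      (hx.exists_combination_three_le hk.le hR (by lia))) (y₀ := (a, 0))
    (fun r hr => hk ▸ finrank_le_of_isShortCombination k (x := fun i =>
        (liftColumns F R 3 x β i).1) hmem ha (hr.map (LinearMap.fst F _ _)))
    (by simpa [hK, hPK, hblocks, liftLength] using hn)
  refine ⟨C, hC, hdim.trans ?_⟩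
  rw [Module.finrank_prod, Module.finrank_pi, Module.finrank_pi_fintype]
  simp [hKrank]
  ring

/-! ### Filling codes and the lower density -/

section Family

variable {F : Type u} [Field F] [DecidableEq F] {R : ℕ}

/-- Filling the gaps between the lengths `L m` of given codes, one gets an infinite family whose
supporting codes are exactly the given ones. -/
theorem exists_coveringFamily {T : ℕ → Prop} {L r : ℕ → ℕ} (hT : T 0) (hL : StrictMono L)
    (hr : StrictMono r) (C : ∀ _ n : ℕ, Submodule F (Fin n → F))
    (hC : ∀ m n, T m → L m ≤ n → HasCoveringRadius (C m n) R ∧ codeCodim (C m n) = r m) :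
    ∃ A : CoveringFamily F R, A.start = L 0 ∧ A.code (L 0) = C 0 (L 0) ∧
      (∀ n, L 0 ≤ n → ∃ m, T m ∧ L m ≤ n ∧ codeCodim (A.code n) = r m ∧
        ∀ m', T m' → L m' ≤ n → m' ≤ m) ∧
      ∀ n d, (A.IsSupporting n ∧ codeCodim (A.code n) = d) ↔ ∃ m, T m ∧ n = L m ∧ d = r m := by
  classical
  -- At length n the largest admissible m with L m ≤ n is used; searching up to n suffices because m
  -- ≤ L m.
  let τ : ℕ → ℕ := fun n => Nat.findGreatest (fun m => T m ∧ L m ≤ n) n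
  have hτ : ∀ n, L 0 ≤ n → T (τ n) ∧ L (τ n) ≤ n := fun n hn =>
    Nat.findGreatest_spec (P := fun m => T m ∧ L m ≤ n) (Nat.zero_le n) ⟨hT, hn⟩
  have hmax : ∀ n m, T m → L m ≤ n → m ≤ τ n := fun n m hm hn =>
    Nat.le_findGreatest ((hL.id_le m).trans hn) ⟨hm, hn⟩
  have hτL : ∀ m, T m → τ (L m) = m := fun m hm =>
    le_antisymm (hL.le_iff_le.1 (hτ (L m) (hL.monotone (Nat.zero_le m))).2) (hmax _ m hm le_rfl)
  have hcodim : ∀ n, L 0 ≤ n → codeCodim (C (τ n) n) = r (τ n) := fun n hn =>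
    (hC _ _ (hτ n hn).1 (hτ n hn).2).2
  let A : CoveringFamily F R :=
    { start := L 0
      code := fun n => C (τ n) n
      radius := fun n hn => (hC _ _ (hτ n hn).1 (hτ n hn).2).1
      codim_mono := fun n hn => by
        rw [hcodim n hn, hcodim (n + 1) (by lia)]
        exact hr.monotone (hmax _ _ (hτ n hn).1 ((hτ n hn).2.trans (Nat.le_succ n))) }
  refine ⟨A, rfl, ?_, fun n hn => ⟨τ n, (hτ n hn).1, (hτ n hn).2, hcodim n hn, hmax n⟩, ?_⟩
  · change C (τ (L 0)) (L 0) = _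
    rw [hτL 0 hT]
  · intro n d
    change ((L 0 ≤ n ∧ (n = L 0 ∨ codeCodim (C (τ (n - 1)) (n - 1)) < codeCodim (C (τ n) n))) ∧
      codeCodim (C (τ n) n) = d) ↔ _
    constructor
    · rintro ⟨⟨hn, h⟩, rfl⟩
      refine ⟨τ n, (hτ n hn).1, ?_, hcodim n hn⟩
      by_cases h0 : n = L 0
      · rw [h0, hτL 0 hT]
      have hlt := h.resolve_left h0
      rw [hcodim n hn, hcodim (n - 1) (by lia), hr.lt_iff_lt] at hlt
      -- If L (τ n) < n, then τ n was already available at length n - 1, so the codimension did not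
      -- jump at n.
      by_contra hne
      have h1 := (hτ n hn).2
      exact absurd (hmax (n - 1) (τ n) (hτ n hn).1 (by lia)) (not_le.2 hlt)
    · rintro ⟨m, hm, rfl, rfl⟩
      have h0 : L 0 ≤ L m := hL.monotone (Nat.zero_le m)
      refine ⟨⟨h0, ?_⟩, by rw [hcodim _ h0, hτL m hm]⟩
      by_cases h : L m = L 0
      · exact Or.inl h
      refine Or.inr ?_
      have h1 : L 0 ≤ L m - 1 := by lia
      rw [hcodim _ h0, hcodim _ h1, hτL m hm, hr.lt_iff_lt, ← hL.lt_iff_lt]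
      have := (hτ _ h1).2
      lia

theorem sphereCard_mono (q R : ℕ) : Monotone fun n => sphereCard q n R := fun _ _ h =>
  Finset.sum_le_sum fun i _ => Nat.mul_le_mul_left _ (Nat.choose_le_choose i h)

/-- The lower density of a family is the limit of the densities of its supporting codes. -/
theorem CoveringFamily.lowerDensity_eq_of_tendsto [Fintype F] (A : CoveringFamily F R)
    {T : ℕ → Prop} {L r : ℕ → ℕ} (hT : ∀ᶠ m in atTop, T m) (hL : StrictMono L)
    (hA : ∀ n, L 0 ≤ n → ∃ m, T m ∧ L m ≤ n ∧ codeCodim (A.code n) = r m ∧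
        ∀ m', T m' → L m' ≤ n → m' ≤ m) {ℓ : ℝ≥0∞}
    (hℓ : Tendsto (fun m => coveringDensity (Fintype.card F) (L m) R (r m)) atTop (𝓝 ℓ)) :
    A.lowerDensity = ℓ := by
  obtain ⟨m₀, hm₀⟩ := eventually_atTop.1 hT
  -- The upper bound uses the lengths L m alone. For the lower bound, the code of length n has the
  -- codimension of some supporting length L t ≤ n, and its sphere is at least as large.
  refine le_antisymm (le_of_forall_gt_imp_ge_of_dense fun c hc => ?_)
    (le_of_forall_lt_imp_le_of_dense fun c hc => ?_)
  · obtain ⟨m₁, hm₁⟩ := eventually_atTop.1 (hℓ.eventually_lt_const hc)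
    refine liminf_le_of_frequently_le' (frequently_atTop.2 fun a => ?_)
    obtain ⟨m, hm⟩ : ∃ m, m = max a (max m₀ m₁) := ⟨_, rfl⟩
    have hTm : T m := hm₀ m (by lia)
    refine ⟨L m, (by lia : a ≤ m).trans (hL.id_le m), ?_⟩
    obtain ⟨t, -, htL, htr, htmax⟩ := hA (L m) (hL.monotone (Nat.zero_le m))
    have : t = m := le_antisymm (hL.le_iff_le.1 htL) (htmax m hTm le_rfl)
    rw [htr, this]
    exact (hm₁ m (by lia)).le
  · obtain ⟨m₁, hm₁⟩ := eventually_atTop.1 (hℓ.eventually_const_lt hc)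
    obtain ⟨m, hm⟩ : ∃ m, m = max m₀ m₁ := ⟨_, rfl⟩
    refine le_liminf_of_le (by isBoundedDefault) (eventually_atTop.2 ⟨L m, fun n hn => ?_⟩)
    obtain ⟨t, -, htL, htr, htmax⟩ := hA n ((hL.monotone (Nat.zero_le m)).trans hn)
    have hmt : m ≤ t := htmax m (hm₀ m (by lia)) hn
    rw [htr]
    refine (hm₁ t (by lia)).le.trans ?_
    unfold coveringDensity
    gcongr
    exact sphereCard_mono _ _ htL

end Family

/-! ### Asymptotics of lengths and densities -/

section Asymptotic

theorem startLength_eq_sum {R γ : ℕ} {q : ℝ} (hq : q ^ (1 / (R : ℝ)) - 1 ≠ 0) :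
    startLength R γ q = ∑ i ∈ Finset.range (γ + 1),
      ((R + γ).choose (i + 1) : ℝ) * (q ^ (1 / (R : ℝ)) - 1) ^ i := by
  rw [startLength, div_eq_iff hq, Finset.sum_mul, ← Finset.Ico_add_one_right_eq_Icc,
    Finset.sum_Ico_eq_sum_range]
  refine Finset.sum_congr rfl fun i _ => ?_
  rw [add_comm 1 i]
  ring

theorem isEquivalent_sum_mul_pow {c : ℕ → ℝ} {d : ℕ} (hc : c d ≠ 0) :
    Asymptotics.IsEquivalent atTop (fun y : ℝ => ∑ i ∈ Finset.range (d + 1), c i * y ^ i)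
      (fun y => c d * y ^ d) := by
  let P : Polynomial ℝ := ∑ i ∈ Finset.range (d + 1), Polynomial.C (c i) * Polynomial.X ^ i
  have hcoeff : P.coeff d = c d := by
    simp [P, Polynomial.coeff_C_mul, Polynomial.coeff_X_pow]
  have hdeg : P.natDegree = d := by
    refine Polynomial.natDegree_eq_of_le_of_coeff_ne_zero ?_ (hcoeff ▸ hc)
    refine Polynomial.natDegree_sum_le_of_forall_le _ _ fun i hi => ?_
    exact (Polynomial.natDegree_C_mul_X_pow_le _ _).trans (Finset.mem_range_succ_iff.1 hi)
  have := P.isEquivalent_atTop_lead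
  rw [Polynomial.leadingCoeff, hdeg, hcoeff] at this
  refine this.congr_left (Eventually.of_forall fun y => ?_)
  simp [P, Polynomial.eval_finsetSum]

theorem tendsto_rpow_one_div_atTop {R : ℕ} (hR : R ≠ 0) :
    Tendsto (fun q : ℝ => q ^ (1 / (R : ℝ))) atTop atTop :=
  tendsto_rpow_atTop (by positivity)

/-- In y = q^(1/R) - 1 the length is a polynomial of degree γ with leading coefficient C(R+γ, γ+1) =
C(R+γ, R-1). -/
theorem isEquivalent_startLength {R γ : ℕ} (hR : R ≠ 0) :
    Asymptotics.IsEquivalent atTop (fun q : ℝ => startLength R γ q)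
      (fun q : ℝ => ((R + γ).choose (R - 1) : ℝ) * q ^ ((γ : ℝ) / R)) := by
  have hsymm : (R + γ).choose (γ + 1) = (R + γ).choose (R - 1) := by
    rw [← Nat.choose_symm (by lia : R - 1 ≤ R + γ)]
    congr 1
    lia
  have hy : Tendsto (fun q : ℝ => q ^ (1 / (R : ℝ)) - 1) atTop atTop :=
    tendsto_atTop_add_const_right _ _ (tendsto_rpow_one_div_atTop hR)
  have h1 := (isEquivalent_sum_mul_pow (c := fun i => ((R + γ).choose (i + 1) : ℝ)) (d := γ)
    (by
      have : 0 < (R + γ).choose (γ + 1) := Nat.choose_pos (by lia)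
      positivity)).comp_tendsto hy
  have h2 : Asymptotics.IsEquivalent atTop (fun q : ℝ => q ^ (1 / (R : ℝ)) - 1)
      (fun q : ℝ => q ^ (1 / (R : ℝ))) :=
    Asymptotics.IsEquivalent.refl.sub_isLittleO
      (Asymptotics.isLittleO_const_left.2 (Or.inr
        (tendsto_norm_atTop_atTop.comp (tendsto_rpow_one_div_atTop hR))))
  have h3 := (Asymptotics.IsEquivalent.refl (u := fun _ : ℝ =>
    ((R + γ).choose (γ + 1) : ℝ)) (l := atTop)).mul (h2.pow γ)
  refine ((h1.congr_left ?_).trans h3).congr_right ?_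
  · filter_upwards [hy.eventually_gt_atTop 0] with q hq
    exact (startLength_eq_sum hq.ne').symm
  · filter_upwards [eventually_ge_atTop 0] with q hq
    simp only [Pi.mul_apply, Pi.pow_apply]
    rw [← Real.rpow_natCast, ← Real.rpow_mul hq, hsymm, one_div_mul_eq_div]

/-- Only the term i = R has order n^R. -/
theorem tendsto_sphereCard_div_pow {q : ℕ} (R : ℕ) (hq : 1 ≤ q) :
    Tendsto (fun n : ℕ => (sphereCard q n R : ℝ) / (n : ℝ) ^ R) atTop
      (𝓝 (((q : ℝ) - 1) ^ R / R.factorial)) := by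
  have hterm : ∀ i ∈ Finset.range (R + 1), Tendsto
      (fun n : ℕ => ((q : ℝ) - 1) ^ i * (n.choose i / (n : ℝ) ^ R)) atTop
      (𝓝 (if i = R then ((q : ℝ) - 1) ^ R / R.factorial else 0)) := by
    intro i hi
    have hchoose : Tendsto (fun n : ℕ => (n.choose i : ℝ) / (n : ℝ) ^ i) atTop
        (𝓝 (1 / i.factorial)) := by
      have h := (isEquivalent_choose i).div
        (Asymptotics.IsEquivalent.refl (u := fun n : ℕ => (n : ℝ) ^ i))
      refine h.symm.tendsto_nhds ?_
      refine tendsto_const_nhds.congr' ?_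
      filter_upwards [eventually_gt_atTop 0] with n hn
      have : (0 : ℝ) < n := by exact_mod_cast hn
      simp only [Pi.div_apply]
      field_simp
    split_ifs with h
    · subst h
      simpa [div_eq_mul_inv] using hchoose.const_mul (((q : ℝ) - 1) ^ i)
    · have hlt : 0 < R - i := by
        have := Finset.mem_range_succ_iff.1 hi
        lia
      have hz : Tendsto (fun n : ℕ => ((n : ℝ) ^ (R - i))⁻¹) atTop (𝓝 0) :=
        tendsto_inv_atTop_zero.comp
          ((tendsto_pow_atTop hlt.ne').comp tendsto_natCast_atTop_atTop)
      have := (hchoose.mul hz).const_mul (((q : ℝ) - 1) ^ i)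
      simp only [mul_zero] at this
      refine this.congr fun n => ?_
      rw [← div_eq_mul_inv, div_div, ← pow_add, Nat.add_sub_of_le (by lia)]
  have hsum := tendsto_finsetSum _ hterm
  rw [Finset.sum_ite_eq' _ _ (fun _ => _), if_pos (Finset.self_mem_range_succ R)] at hsum
  refine hsum.congr fun n => ?_
  rw [sphereCard, Nat.cast_sum, Finset.sum_div]
  refine Finset.sum_congr rfl fun i _ => ?_
  push_cast [Nat.cast_sub hq]
  rw [mul_div_assoc]

theorem cast_liftLength {q n₀ w m : ℕ} (hq : 2 ≤ q) :
    (liftLength q n₀ w m : ℝ) =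
      n₀ * (q : ℝ) ^ m + w * (((q : ℝ) ^ m - 1) / ((q : ℝ) - 1)) := by
  have hq1 : (q : ℝ) ≠ 1 := by
    have : (2 : ℝ) ≤ q := by exact_mod_cast hq
    linarith
  simp [liftLength, geom_sum_eq hq1]

theorem tendsto_liftLength_div_pow {q n₀ w : ℕ} (hq : 2 ≤ q) :
    Tendsto (fun m => (liftLength q n₀ w m : ℝ) / (q : ℝ) ^ m) atTop
      (𝓝 (n₀ + w / ((q : ℝ) - 1))) := by
  have hq2 : (2 : ℝ) ≤ q := by exact_mod_cast hq
  have h0 : Tendsto (fun m : ℕ => ((q : ℝ)⁻¹) ^ m) atTop (𝓝 0) :=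
    tendsto_pow_atTop_nhds_zero_of_lt_one (by positivity) (inv_lt_one_of_one_lt₀ (by linarith))
  have h1 := ((h0.const_sub 1).const_mul (w / ((q : ℝ) - 1))).const_add (n₀ : ℝ)
  rw [sub_zero, mul_one] at h1
  refine h1.congr fun m => ?_
  have : (0 : ℝ) < (q : ℝ) - 1 := by linarith
  rw [cast_liftLength hq, inv_pow]
  field_simp

theorem tendsto_sphereCard_liftLength {q n₀ w R γ : ℕ} (hq : 2 ≤ q) (hn₀ : 1 ≤ n₀) :
    Tendsto (fun m => (sphereCard q (liftLength q n₀ w m) R : ℝ) /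
        (q : ℝ) ^ (R * (m + 1) + γ)) atTop
      (𝓝 (((q : ℝ) - 1) ^ R * (n₀ + w / ((q : ℝ) - 1)) ^ R /
        (R.factorial * (q : ℝ) ^ (R + γ)))) := by
  have hL := strictMono_liftLength (w := w) hq hn₀
  have h1 := ((tendsto_sphereCard_div_pow R (by lia : 1 ≤ q)).comp hL.tendsto_atTop).mul
    ((tendsto_liftLength_div_pow (n₀ := n₀) (w := w) hq).pow R)
  have h2 := h1.div_const ((q : ℝ) ^ (R + γ))
  have hq0 : (0 : ℝ) < q := by exact_mod_cast (by lia : 0 < q)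
  have hlim : ((q : ℝ) - 1) ^ R / R.factorial * (n₀ + w / ((q : ℝ) - 1)) ^ R /
      (q : ℝ) ^ (R + γ) = ((q : ℝ) - 1) ^ R * (n₀ + w / ((q : ℝ) - 1)) ^ R /
        (R.factorial * (q : ℝ) ^ (R + γ)) := by
    rw [div_mul_eq_mul_div, div_div]
  rw [hlim] at h2
  refine h2.congr' ?_
  filter_upwards [eventually_gt_atTop 0] with m hm
  have hpos : (0 : ℝ) < liftLength q n₀ w m := by
    exact_mod_cast hm.trans_le (hL.id_le m)
  simp only [Function.comp_apply]
  rw [div_pow, div_mul_div_cancel₀ (by positivity), div_div]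
  ring_nf

/-- The lower density of the family over the field with `q` elements. -/
noncomputable def limitDensity (R γ : ℕ) (q : ℝ) : ℝ :=
  (q - 1) ^ R * (startLength R γ q + ((R - 3 : ℕ) : ℝ) / (q - 1)) ^ R /
    (R.factorial * q ^ (R + γ))

/-- The density is (1 - 1/q)^R times the R-th power of the bracket divided by q^(γ/R), over R!; the
contribution of w to the bracket vanishes in the limit. -/
theorem tendsto_limitDensity {R γ : ℕ} (hR : R ≠ 0) (hγ : γ ≠ 0) :
    Tendsto (limitDensity R γ) atTop
      (𝓝 (((R + γ).choose (R - 1) : ℝ) ^ R / (R.factorial : ℝ))) := by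
  have hpos : (0 : ℝ) < γ / R := by positivity
  have hchoose : (0 : ℝ) < (R + γ).choose (R - 1) := by
    exact_mod_cast Nat.choose_pos (by lia : R - 1 ≤ R + γ)
  have h1 : Tendsto (fun q : ℝ => 1 - q⁻¹) atTop (𝓝 1) := by
    simpa using tendsto_inv_atTop_zero.const_sub (1 : ℝ)
  have h2 : Tendsto (fun q : ℝ => startLength R γ q / q ^ ((γ : ℝ) / R)) atTop
      (𝓝 ((R + γ).choose (R - 1) : ℝ)) := by
    have h := (isEquivalent_startLength (γ := γ) hR).div
      (Asymptotics.IsEquivalent.refl (u := fun q : ℝ => q ^ ((γ : ℝ) / R)))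
    refine h.symm.tendsto_nhds (tendsto_const_nhds.congr' ?_)
    filter_upwards [eventually_gt_atTop 0] with q hq
    have := Real.rpow_pos_of_pos hq ((γ : ℝ) / R)
    simp only [Pi.div_apply]
    field_simp
  have h3 : Tendsto (fun q : ℝ => ((R - 3 : ℕ) : ℝ) / (q - 1) / q ^ ((γ : ℝ) / R)) atTop
      (𝓝 0) :=
    (tendsto_const_nhds.div_atTop
      (tendsto_atTop_add_const_right _ (-1 : ℝ) tendsto_id)).div_atTop (tendsto_rpow_atTop hpos)
  have h4 := ((h1.pow R).mul ((h2.add h3).pow R)).div_const (R.factorial : ℝ)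
  rw [one_pow, one_mul, add_zero] at h4
  refine h4.congr' ?_
  filter_upwards [eventually_gt_atTop 1] with q hq
  have hq0 : 0 < q := by linarith
  have hpow : (q ^ ((γ : ℝ) / R)) ^ R = q ^ γ := by
    rw [← Real.rpow_natCast, ← Real.rpow_mul hq0.le, div_mul_cancel₀ _ (by positivity),
      Real.rpow_natCast]
  have hsub : 1 - q⁻¹ = (q - 1) / q := by field_simp
  rw [limitDensity, hsub, ← add_div, div_pow, div_pow, hpow, div_mul_div_comm, div_div,
    ← pow_add, mul_comm (R.factorial : ℝ)]

end Asymptotic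

/-! ### Assembly of the family and the theorem -/

theorem startLength_natCast_pow {R γ s n₀ : ℕ} (hR : 1 ≤ R) (hs : 2 ≤ s)
    (hn₀ : n₀ * (s - 1) =
      ∑ i ∈ Finset.Icc 1 (R + γ - (R - 1)), (s - 1) ^ i * (R + γ).choose i) :
    startLength R γ ((s ^ R : ℕ) : ℝ) = n₀ := by
  have hroot : (((s ^ R : ℕ) : ℝ)) ^ (1 / (R : ℝ)) = s := by
    rw [Nat.cast_pow, one_div, Real.pow_rpow_inv_natCast (Nat.cast_nonneg s) (by lia)]
  have hs2 : (2 : ℝ) ≤ s := by exact_mod_cast hs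
  have hcast : ((s - 1 : ℕ) : ℝ) = (s : ℝ) - 1 := by
    rw [Nat.cast_sub (by lia), Nat.cast_one]
  rw [startLength, hroot, div_eq_iff (by linarith), ← hcast]
  rw [show R + γ - (R - 1) = γ + 1 by lia] at hn₀
  exact_mod_cast hn₀.symm

theorem familyLength_eq {R γ w q m : ℕ} (hR : 1 ≤ R) :
    familyLength R γ w q (R * (m + 1) + γ) =
      startLength R γ q * (q : ℝ) ^ m + w * (((q : ℝ) ^ m - 1) / ((q : ℝ) - 1)) := by
  have hexp : (((R * (m + 1) + γ : ℕ) : ℝ) - ((R : ℝ) + γ)) / R = m := by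
    have : (0 : ℝ) < R := by exact_mod_cast hR
    push_cast
    field_simp
    ring
  rw [familyLength, hexp, Real.rpow_natCast]

theorem coveringDensity_eq_ofReal {q n R r : ℕ} (hq : 1 ≤ q) :
    coveringDensity q n R r = ENNReal.ofReal ((sphereCard q n R : ℝ) / (q : ℝ) ^ r) := by
  have hq0 : (0 : ℝ) < q := by exact_mod_cast hq
  rw [coveringDensity, ENNReal.ofReal_div_of_pos (by positivity), ENNReal.ofReal_natCast,
    ENNReal.ofReal_pow hq0.le, ENNReal.ofReal_natCast]

/-- The family of codes over a field with `s ^ R` elements. -/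
theorem exists_lifted_family {R γ s : ℕ} (hR : 4 ≤ R) (hγ : 2 ≤ γ) {F : Type u} [Field F]
    [Fintype F] [DecidableEq F] (hF : Fintype.card F = s ^ R) :
    ∃ (N : ℕ → ℕ) (A : CoveringFamily F R),
      (∀ t, 1 ≤ t → (N t : ℝ) =
        familyLength R γ (R - 3) (Fintype.card F : ℕ) (R * t + γ)) ∧
      (∀ n r, (A.IsSupporting n ∧ codeCodim (A.code n) = r) ↔
        ∃ t, IsAdmissible R γ (Fintype.card F : ℕ) t ∧ n = N t ∧ r = R * t + γ) ∧
      IsSaturating (R - 1) (lowWeightPoints F s (R + γ) (R - 1)) ∧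
      IsRelatedCode (A.code (N 1)) (lowWeightPoints F s (R + γ) (R - 1)) ∧
      A.lowerDensity = ENNReal.ofReal (limitDensity R γ (Fintype.card F : ℕ)) := by
  classical
  obtain ⟨k, hmem, hkcard, hk, hs⟩ := exists_subfield_of_card_eq_pow (by lia) hF
  obtain ⟨n₀, x, hx, hcount⟩ := exists_isLowWeightSystem k (R + γ) (R - 1)
  rw [hkcard] at hcount
  set q := Fintype.card F with hq
  have hq2 : 2 ≤ q := Fintype.one_lt_card
  have hstart : startLength R γ (q : ℝ) = n₀ := by
    rw [hF]
    exact startLength_natCast_pow (by lia) hs hcount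
  have hn₀ : 1 ≤ n₀ := by
    obtain ⟨j, -⟩ := hx.complete (Pi.single ⟨0, by lia⟩ 1) (by simp)
      (fun j => by
        by_cases h : j = ⟨0, by lia⟩
        · subst h; simp
        · simp [h])
      (by rw [← card_vecSupport, vecSupport_single one_ne_zero, Finset.card_singleton]; lia)
    exact j.pos
  set L := liftLength q n₀ (R - 3) with hL
  have hLmono : StrictMono L := strictMono_liftLength hq2 hn₀
  have hL0 : L 0 = n₀ := by simp [hL, liftLength]
  set T : ℕ → Prop := fun m => m = 0 ∨ n₀ ≤ q ^ m with hT
  have hTev : ∀ᶠ m in atTop, T m := by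
    filter_upwards [eventually_ge_atTop n₀] with m hm
    exact Or.inr (hm.trans (Nat.lt_pow_self hq2).le)
  -- The code at m = 0 and n = n₀ must be the kernel of the system itself, to be related to the
  -- point set; `⊤` is a default for pairs never used.
  have hcode : ∀ m n, ∃ C : Submodule F (Fin n → F), T m → L m ≤ n →
      (HasCoveringRadius C R ∧ codeCodim C = R * (m + 1) + γ) ∧
      (m = 0 → n = n₀ → IsRelatedCode C (lowWeightPoints F s (R + γ) (R - 1))) := by
    intro m n
    by_cases h : T m ∧ L m ≤ n
    · by_cases h0 : m = 0 ∧ n = n₀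
      · obtain ⟨rfl, rfl⟩ := h0
        obtain ⟨a, ha⟩ := exists_span_range_eq_top (N := R + γ) k
          (hk.trans_le (Nat.le_add_right R γ))
        have hcov := hx.isShortCombination hk.le (Nat.le_add_right R γ)
        refine ⟨LinearMap.ker (Fintype.linearCombination F x), fun _ _ => ⟨⟨?_, ?_⟩,
          fun _ _ => hx.isRelatedCode hmem⟩⟩
        · exact hasCoveringRadius_ker x hcov (y₀ := a) fun r hr =>
            hk ▸ finrank_le_of_isShortCombination k hx.mem ha hr
        · rw [codeCodim_ker x hcov]
          simp
      · obtain ⟨C, hC⟩ := hx.exists_code (n := n) hk hR hγ h.1 h.2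
        exact ⟨C, fun _ _ => ⟨hC, fun h1 h2 => absurd ⟨h1, h2⟩ h0⟩⟩
    · exact ⟨⊤, fun h1 h2 => absurd ⟨h1, h2⟩ h⟩
  choose C hC using hcode
  have hrmono : StrictMono fun m => R * (m + 1) + γ := by
    intro a b hab
    have := Nat.mul_lt_mul_of_pos_left (Nat.succ_lt_succ hab) (by lia : 0 < R)
    simpa using this
  obtain ⟨A, -, hA0, hAmax, hAsupp⟩ := exists_coveringFamily (T := T) (Or.inl rfl) hLmono hrmono C
    fun m n hm hn => (hC m n hm hn).1
  refine ⟨fun t => L (t - 1), A, ?_, ?_, isSaturating_lowWeightPoints hmem hk (by lia)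
    (Nat.le_add_right R γ), ?_, ?_⟩
  · intro t ht
    obtain ⟨m, rfl⟩ := Nat.exists_eq_add_of_le' ht
    rw [familyLength_eq (by lia), hstart, hL]
    exact cast_liftLength hq2
  · intro n r
    have hadm : ∀ m, IsAdmissible R γ (q : ℝ) (m + 1) ↔ T m := by
      intro m
      rw [IsAdmissible, hstart, hT]
      simp only [Nat.add_eq_right, Nat.le_add_left, true_and, Nat.add_sub_cancel]
      norm_cast
    rw [hAsupp]
    constructor
    · rintro ⟨m, hm, rfl, rfl⟩
      exact ⟨m + 1, (hadm m).2 hm, by simp, rfl⟩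
    · rintro ⟨t, ht, rfl, rfl⟩
      obtain ⟨m, rfl⟩ : ∃ m, t = m + 1 := by
        rcases ht with rfl | ⟨ht, -⟩
        · exact ⟨0, rfl⟩
        · exact Nat.exists_eq_add_of_le' ht
      exact ⟨m, (hadm m).1 ht, by simp, rfl⟩
  · change IsRelatedCode (A.code (L 0)) _
    rw [hA0]
    exact (hC 0 (L 0) (Or.inl rfl) le_rfl).2 rfl hL0
  · refine A.lowerDensity_eq_of_tendsto hTev hLmono hAmax ?_
    simp only [coveringDensity_eq_ofReal (by lia : 1 ≤ Fintype.card F)]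
    rw [limitDensity, hstart]
    exact ENNReal.tendsto_ofReal (tendsto_sphereCard_liftLength hq2 hn₀)

theorem mainTheorem9 (R γ : ℕ) (hR : 4 ≤ R) (hγ : 2 ≤ γ) (hγR : γ ≤ R - 1) :
    Asymptotics.IsEquivalent atTop (fun q : ℝ => startLength R γ q)
      (fun q : ℝ => ((R + γ).choose (R - 1) : ℝ) * q ^ ((γ : ℝ) / R)) ∧
    ∃ (M : ℝ) (δ : ℕ → ℝ), Tendsto δ atTop (𝓝 0) ∧
      ∀ (s : ℕ) (F : Type u) [Field F] [Fintype F] [DecidableEq F] (q : ℕ),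
        Fintype.card F = q → q = s ^ R →
        ∃ (w : ℕ) (N : ℕ → ℕ) (A : CoveringFamily F R),
          w ≤ R - 3 ∧
          (∀ t, 1 ≤ t → (N t : ℝ) = familyLength R γ w q (R * t + γ)) ∧
          (∀ n r, (A.IsSupporting n ∧ codeCodim (A.code n) = r) ↔
            ∃ t, IsAdmissible R γ q t ∧ n = N t ∧ r = R * t + γ) ∧
          IsSaturating (R - 1) (lowWeightPoints F s (R + γ) (R - 1)) ∧
          IsRelatedCode (A.code (N 1)) (lowWeightPoints F s (R + γ) (R - 1)) ∧
          A.lowerDensity ≤ ENNReal.ofReal M ∧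
          ENNReal.ofReal (((R + γ).choose (R - 1) : ℝ) ^ R / (R.factorial : ℝ) - δ q) ≤
            A.lowerDensity ∧
          A.lowerDensity ≤
            ENNReal.ofReal (((R + γ).choose (R - 1) : ℝ) ^ R / (R.factorial : ℝ) + δ q) := by
  have hR0 : R ≠ 0 := by lia
  have hlim := (tendsto_limitDensity hR0 (by lia : γ ≠ 0)).comp
    (tendsto_natCast_atTop_atTop (R := ℝ))
  set c : ℝ := ((R + γ).choose (R - 1) : ℝ) ^ R / (R.factorial : ℝ)
  -- The density depends on q only through `limitDensity`, and a sequence converging over all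
  -- natural q is bounded, so `M` depends on R and γ alone.
  obtain ⟨M, hM⟩ := hlim.bddAbove_range
  refine ⟨isEquivalent_startLength hR0, M, fun q => |limitDensity R γ q - c|, ?_, ?_⟩
  · simpa using (hlim.sub_const c).abs
  · intro s F _ _ _ q hq hs
    obtain ⟨N, A, hN, hsupp, hsat, hrel, hdens⟩ :=
      exists_lifted_family (γ := γ) hR hγ (hq.trans hs)
    rw [hq] at hN hsupp hdens
    refine ⟨R - 3, N, A, le_rfl, hN, hsupp, hsat, hrel, ?_⟩
    rw [hdens]
    refine ⟨ENNReal.ofReal_le_ofReal (hM ⟨q, rfl⟩), ENNReal.ofReal_le_ofReal ?_,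
      ENNReal.ofReal_le_ofReal ?_⟩
    · have := neg_abs_le (limitDensity R γ q - c)
      linarith
    · have := le_abs_self (limitDensity R γ q - c)
      linarith
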